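/- Fix an integer $g\ge 3$. If $G$ is a (finite, simple) $n$-vertex planar graph of girth $g$ (that is, the shortest cycle of $G$ has length exactly $g$), then its number $e(G)$ of edges satisfies $e(G)\le \frac{g}{g-2}(n-2)$. For each integer $g\ge 6$ this bound holds with equality infinitely often, that is, for infinitely many $n$ there is an $n$-vertex planar graph of girth $g$ with exactly $\frac{g}{g-2}(n-2)$ edges. Specifically, whenever $k$ is a positive even integer and $n=(5g-10)\frac{k}{2}-g+4$, there is an $n$-vertex planar graph $G$ of girth $g$ with $e(G)=\frac{g}{g-2}(n-2)$ in which every vertex has degree 2 or 3. -/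

import Mathlib

/-- `S` is a (simple) polygonal arc in the plane with ends `p` and `q`: the union of finitely many
nondegenerate straight line segments `[pt 0, pt 1], …, [pt (m - 1), pt m]`, `m ≥ 1`, leading from
`p` to `q`, such that consecutive segments meet only in their common end and nonconsecutive
segments are disjoint. -/
def IsPolygonalArc (p q : ℝ × ℝ) (S : Set (ℝ × ℝ)) : Prop :=
  ∃ (m : ℕ) (pt : ℕ → ℝ × ℝ), 0 < m ∧ pt 0 = p ∧ pt m = q ∧
    (∀ i < m, pt i ≠ pt (i + 1)) ∧
    (∀ i, i + 1 < m →
      segment ℝ (pt i) (pt (i + 1)) ∩ segment ℝ (pt (i + 1)) (pt (i + 2)) = {pt (i + 1)}) ∧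
    (∀ i j, i + 1 < j → j < m →
      Disjoint (segment ℝ (pt i) (pt (i + 1))) (segment ℝ (pt j) (pt (j + 1)))) ∧
    S = ⋃ i ∈ Set.Iio m, segment ℝ (pt i) (pt (i + 1))

/-- A drawing of the graph `G` in the plane without crossings: vertices are distinct points, every
edge is a polygonal arc joining its two ends, an edge contains no vertex other than its ends, and
two distinct edges have no common point other than a common end. -/
structure PlaneDrawing {V : Type*} (G : SimpleGraph V) where
  /-- the point that represents a vertex -/
  pos : V → ℝ × ℝ
  /-- the arc that represents an edge (values at non-edges are irrelevant) -/
  curve : Sym2 V → Set (ℝ × ℝ)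
  pos_injective : Function.Injective pos
  isPolygonalArc : ∀ u v, G.Adj u v → IsPolygonalArc (pos u) (pos v) (curve s(u, v))
  vertex_mem : ∀ e ∈ G.edgeSet, ∀ w, pos w ∈ curve e → w ∈ e
  inter_subset : ∀ e ∈ G.edgeSet, ∀ f ∈ G.edgeSet, e ≠ f →
    curve e ∩ curve f ⊆ pos '' {w | w ∈ e ∧ w ∈ f}

/-- A graph is planar if it can be drawn in the plane without crossings. -/
def IsPlanarGraph {V : Type*} (G : SimpleGraph V) : Prop :=
  Nonempty (PlaneDrawing G)

/-! Upper bound: homology modulo 2 replaces Euler's formula. After a choice of direction, the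
segments of a drawing are graphs of functions over intervals. For an arc `s`, the parity of the
number of arcs of a cycle above a point just above `s` is a linear form `wind s` on the cycle space;
just below `s` the form is `wind s + ev s`. The forms that occur beside arcs lying on cycles play
the role of faces. They separate cycles and include 0, so there are at least dim + 1 of them
(`finrank_lt_card_faces`). The arcs with a given face on exactly one side form a nonzero cycle
(`bdry_mem`, `bdry_ne_zero`), hence use at least g edges, and each edge borders at most two faces.
So g(dim + 1) ≤ 2e, and dim ≥ e - n + 1 gives the bound (`girth_mul_le`).

Sharpness: with q = g - 2, take a path on q(M + 1) + 2 vertices, coil it into a spiral, and join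
successive windings by 2M + 1 chords, from `lo q i` to `hi q i`. It has (q + 2)(M + 1) edges, which
is equality in the bound. Every cycle has length at least q + 2: its largest vertex is the outer end
`hi q i` of a chord of the cycle, and a function that is 1-Lipschitz along the remaining edges
climbs from 0 at `lo q i` to q + 1 at `hi q i` (`le_length`). The girth cannot exceed q + 2, because
the edge count would then violate the upper bound (`girth_eq`). The chords are pairwise disjoint and
the ends of the path carry chords, so all degrees are 2 or 3. -/

open Classical in
/-- The indicator of a proposition, with values in `ZMod 2`. -/
noncomputable def ind₂ (p : Prop) : ZMod 2 := if p then 1 else 0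

lemma ind₂_true {p : Prop} (h : p) : ind₂ p = 1 := if_pos h

lemma ind₂_false {p : Prop} (h : ¬ p) : ind₂ p = 0 := if_neg h

lemma ind₂_congr {p q : Prop} (h : p ↔ q) : ind₂ p = ind₂ q := by rw [propext h]

/-! ### Faces of a system of plane arcs, through winding numbers modulo 2. -/

/-- A finite family of non-vertical, non-crossing segments, seen as a family of graphs of continuous
functions `y t` over intervals `[α t, β t]`. Different end points have different abscissas, and
`η x` is the ordinate of the end point with abscissa `x`. -/
structure ArcSystem (T : Type*) where
  α : T → ℝ
  β : T → ℝ
  y : T → ℝ → ℝ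
  η : ℝ → ℝ
  lt : ∀ t, α t < β t
  continuous : ∀ t, Continuous (y t)
  y_left : ∀ t, y t (α t) = η (α t)
  y_right : ∀ t, y t (β t) = η (β t)
  y_ne : ∀ s t, s ≠ t → ∀ x ∈ Set.Ioo (α s) (β s), x ∈ Set.Icc (α t) (β t) → y s x ≠ y t x

namespace ArcSystem

variable {T : Type*} (A : ArcSystem T)

/-- Two different arcs do not change their vertical order. -/
lemma lt_of_lt {s t : T} (hst : s ≠ t) {x x' : ℝ} (hx : x ∈ Set.Ioo (A.α s) (A.β s))
    (hx' : x' ∈ Set.Ioo (A.α s) (A.β s)) (hxt : x ∈ Set.Icc (A.α t) (A.β t))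
    (hxt' : x' ∈ Set.Icc (A.α t) (A.β t)) (h : A.y s x < A.y t x) : A.y s x' < A.y t x' := by
  by_contra hcon
  have hc : ContinuousOn (fun z => A.y t z - A.y s z) (Set.uIcc x x') :=
    ((A.continuous t).sub (A.continuous s)).continuousOn
  have h0 : (0 : ℝ) ∈ Set.uIcc (A.y t x - A.y s x) (A.y t x' - A.y s x') := by
    rw [Set.mem_uIcc]; right; constructor <;> linarith
  obtain ⟨z, hz, hz0⟩ := intermediate_value_uIcc hc h0
  have hz1 : z ∈ Set.Ioo (A.α s) (A.β s) := Set.OrdConnected.uIcc_subset inferInstance hx hx' hz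
  have hz2 : z ∈ Set.Icc (A.α t) (A.β t) := Set.OrdConnected.uIcc_subset inferInstance hxt hxt' hz
  exact A.y_ne s t hst z hz1 hz2 (by simp only at hz0; linarith)

variable [Fintype T]

/-- The chains modulo 2 with zero boundary. -/
def cycles : Submodule (ZMod 2) (T → ZMod 2) where
  carrier := {Z | ∀ v, ∑ t, Z t * (ind₂ (A.α t = v) + ind₂ (A.β t = v)) = 0}
  add_mem' := by
    intro Z Z' h h' v
    simp only [Pi.add_apply, add_mul, Finset.sum_add_distrib]
    rw [h v, h' v, add_zero]
  zero_mem' := by simp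
  smul_mem' := by
    intro c Z h v
    simp only [Pi.smul_apply, smul_eq_mul, mul_assoc]
    rw [← Finset.mul_sum, h v, mul_zero]

lemma mem_cycles {Z : T → ZMod 2} :
    Z ∈ A.cycles ↔ ∀ v, ∑ t, Z t * (ind₂ (A.α t = v) + ind₂ (A.β t = v)) = 0 := Iff.rfl

/-- The finite set of abscissas of end points. -/
noncomputable def ends : Finset ℝ := by
  classical exact Finset.univ.image A.α ∪ Finset.univ.image A.β

lemma left_mem (t : T) : A.α t ∈ A.ends := by simp [ends]

lemma right_mem (t : T) : A.β t ∈ A.ends := by simp [ends]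

/-- A cycle has an even number of edge ends in every set of vertices. -/
lemma sum_region {Z : T → ZMod 2} (hZ : Z ∈ A.cycles) (R : ℝ → Prop) :
    ∑ t, Z t * (ind₂ (R (A.α t)) + ind₂ (R (A.β t))) = 0 := by
  classical
  have key : ∀ x ∈ A.ends, ind₂ (R x) = ∑ v ∈ A.ends, ind₂ (R v) * ind₂ (x = v) := by
    intro x hx
    rw [Finset.sum_eq_single x]
    · simp [ind₂]
    · intro b _ hb
      rw [ind₂_false (p := x = b) (fun h => hb h.symm), mul_zero]
    · exact fun h => absurd hx h
  calc ∑ t, Z t * (ind₂ (R (A.α t)) + ind₂ (R (A.β t)))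
      = ∑ t, ∑ v ∈ A.ends, ind₂ (R v) * (Z t * (ind₂ (A.α t = v) + ind₂ (A.β t = v))) := by
        refine Finset.sum_congr rfl fun t _ => ?_
        rw [key _ (A.left_mem t), key _ (A.right_mem t), ← Finset.sum_add_distrib, Finset.mul_sum]
        exact Finset.sum_congr rfl fun v _ => by ring
    _ = ∑ v ∈ A.ends, ind₂ (R v) * ∑ t, Z t * (ind₂ (A.α t = v) + ind₂ (A.β t = v)) := by
        rw [Finset.sum_comm]
        simp only [Finset.mul_sum]
    _ = 0 := Finset.sum_eq_zero fun v _ => by rw [hZ v, mul_zero]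

/-- The arc `t` passes over the abscissa `x`. -/
def Active (x : ℝ) (t : T) : Prop := A.α t < x ∧ x < A.β t

/-- An arc passes over `x` exactly when one of its two ends, and not the other, lies to the left of
`x`; a cycle has an even number of ends there. -/
lemma sum_active {Z : T → ZMod 2} (hZ : Z ∈ A.cycles) {x : ℝ} (hx : x ∉ A.ends) :
    ∑ t, Z t * ind₂ (A.Active x t) = 0 := by
  rw [← A.sum_region hZ (· < x)]
  refine Finset.sum_congr rfl fun t _ => ?_
  congr 1
  have h1 : A.α t ≠ x := fun h => hx (h ▸ A.left_mem t)
  have h2 : A.β t ≠ x := fun h => hx (h ▸ A.right_mem t)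
  have h3 := A.lt t
  rcases lt_or_gt_of_ne h1 with ha | ha <;> rcases lt_or_gt_of_ne h2 with hb | hb
  · rw [ind₂_true ha, ind₂_true hb, ind₂_false (fun h => lt_asymm h.2 hb)]; decide
  · rw [ind₂_true ha, ind₂_false (lt_asymm hb), ind₂_true ⟨ha, hb⟩]; decide
  · linarith
  · rw [ind₂_false (lt_asymm ha), ind₂_false (lt_asymm hb), ind₂_false (fun h => lt_asymm h.1 ha)]
    decide

lemma exists_generic {a b : ℝ} (h : a < b) : ∃ x ∈ Set.Ioo a b, x ∉ A.ends := by
  obtain ⟨x, hx, hx'⟩ := (Set.Ioo_infinite h).exists_notMem_finset A.ends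
  exact ⟨x, hx, hx'⟩

/-- The arc `t` passes over the abscissa `x`, above the arc `s`. -/
def Above (s : T) (x : ℝ) (t : T) : Prop := A.Active x t ∧ A.y s x < A.y t x

/-- An arc cannot cross `s`, so it enters or leaves the region above `s` between the abscissas `x`
and `x'` only through the two vertical sides, or by ending inside. The case analysis places the ends
of `t` relative to `x` and `x'`. -/
lemma ind_above_add (s t : T) {x x' : ℝ} (hxx : x < x') (hx : A.α s < x) (hx' : x' < A.β s)
    (gx : x ∉ A.ends) (gx' : x' ∉ A.ends) :
    ind₂ (A.Above s x t) + ind₂ (A.Above s x' t) =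
      ind₂ (x < A.α t ∧ A.α t < x' ∧ A.y s (A.α t) < A.η (A.α t)) +
      ind₂ (x < A.β t ∧ A.β t < x' ∧ A.y s (A.β t) < A.η (A.β t)) := by
  have a1 : A.α t ≠ x := fun h => gx (h ▸ A.left_mem t)
  have a2 : A.β t ≠ x := fun h => gx (h ▸ A.right_mem t)
  have a3 : A.α t ≠ x' := fun h => gx' (h ▸ A.left_mem t)
  have a4 : A.β t ≠ x' := fun h => gx' (h ▸ A.right_mem t)
  have hlt := A.lt t
  by_cases hst : s = t
  · subst hst
    rw [ind₂_false, ind₂_false, ind₂_false, ind₂_false]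
    · rintro ⟨_, h, _⟩; linarith
    · rintro ⟨h, _⟩; linarith
    · exact fun h => lt_irrefl _ h.2
    · exact fun h => lt_irrefl _ h.2
  have order : ∀ {z z' : ℝ}, x ≤ z → z ≤ x' → x ≤ z' → z' ≤ x' → A.α t ≤ z → z ≤ A.β t →
      A.α t ≤ z' → z' ≤ A.β t → (A.y s z < A.y t z ↔ A.y s z' < A.y t z') := by
    intro z z' h1 h2 h3 h4 h5 h6 h7 h8
    have i1 : z ∈ Set.Ioo (A.α s) (A.β s) := ⟨by linarith, by linarith⟩
    have i2 : z' ∈ Set.Ioo (A.α s) (A.β s) := ⟨by linarith, by linarith⟩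
    exact ⟨A.lt_of_lt hst i1 i2 ⟨h5, h6⟩ ⟨h7, h8⟩, A.lt_of_lt hst i2 i1 ⟨h7, h8⟩ ⟨h5, h6⟩⟩
  rw [← A.y_left, ← A.y_right]
  have two : ∀ a : ZMod 2, a + a = 0 := by decide
  unfold Above Active
  rcases lt_or_gt_of_ne a1 with h1 | h1
  · rw [ind₂_false (p := x < A.α t ∧ _) (fun h => by linarith [h.1]), zero_add]
    rcases lt_or_gt_of_ne a2 with h2 | h2
    · rw [ind₂_false, ind₂_false, ind₂_false]
      · simp
      · exact fun h => by linarith [h.1]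
      · exact fun h => by linarith [h.1.2]
      · exact fun h => by linarith [h.1.2]
    · rcases lt_or_gt_of_ne a4 with h4 | h4
      · rw [ind₂_false (p := (A.α t < x' ∧ x' < A.β t) ∧ _) (fun h => by linarith [h.1.2]),
          add_zero]
        apply ind₂_congr
        have := order (z := x) (z' := A.β t) (by linarith) (by linarith) (by linarith)
          (by linarith) (by linarith) (by linarith) (by linarith) (by linarith)
        tauto
      · rw [ind₂_false (p := x < A.β t ∧ _) (fun h => by linarith [h.2.1])]
        have := order (z := x) (z' := x') (by linarith) (by linarith) (by linarith)
          (by linarith) (by linarith) (by linarith) (by linarith) (by linarith)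
        rw [ind₂_congr (q := (A.α t < x' ∧ x' < A.β t) ∧ A.y s x' < A.y t x'), two]
        have : A.α t < x' := by linarith
        tauto
  · rw [ind₂_false (p := (A.α t < x ∧ _) ∧ _) (fun h => by linarith [h.1.1]), zero_add]
    rcases lt_or_gt_of_ne a3 with h3 | h3
    · rcases lt_or_gt_of_ne a4 with h4 | h4
      · have := order (z := A.α t) (z' := A.β t) (by linarith) (by linarith) (by linarith)
          (by linarith) (by linarith) (by linarith) (by linarith) (by linarith)
        have : x < A.β t := by linarith
        rw [ind₂_false (p := (A.α t < x' ∧ _) ∧ _) (fun h => by linarith [h.1.2]),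
          ind₂_congr (q := x < A.β t ∧ A.β t < x' ∧ A.y s (A.β t) < A.y t (A.β t)), two]
        tauto
      · rw [ind₂_false (p := x < A.β t ∧ _) (fun h => by linarith [h.2.1]), add_zero]
        apply ind₂_congr
        have := order (z := A.α t) (z' := x') (by linarith) (by linarith) (by linarith)
          (by linarith) (by linarith) (by linarith) (by linarith) (by linarith)
        tauto
    · rw [ind₂_false, ind₂_false, ind₂_false]
      · simp
      · exact fun h => by linarith [h.2.1]
      · exact fun h => by linarith [h.2.1]
      · exact fun h => by linarith [h.1.1]

/-- The number modulo 2 of the arcs of a cycle above `s` does not depend on the abscissa. -/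
lemma sum_above_eq {Z : T → ZMod 2} (hZ : Z ∈ A.cycles) (s : T) {x x' : ℝ}
    (hx : A.Active x s) (hx' : A.Active x' s) (gx : x ∉ A.ends) (gx' : x' ∉ A.ends) :
    ∑ t, Z t * ind₂ (A.Above s x t) = ∑ t, Z t * ind₂ (A.Above s x' t) := by
  wlog hxx : x < x' generalizing x x'
  · rcases eq_or_lt_of_le (not_lt.mp hxx) with h | h
    · rw [h]
    · exact (this hx' hx gx' gx h).symm
  have h := A.sum_region hZ (fun v => x < v ∧ v < x' ∧ A.y s v < A.η v)
  simp only [← A.ind_above_add s _ hxx hx.1 hx'.2 gx gx', mul_add, Finset.sum_add_distrib] at h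
  have two : ∀ a b : ZMod 2, a + b = 0 → a = b := by decide
  exact two _ _ h

/-- Evaluation of a cycle at an arc. -/
def ev (t : T) : Module.Dual (ZMod 2) A.cycles :=
  (LinearMap.proj t).comp A.cycles.subtype

@[simp] lemma ev_apply (t : T) (Z : A.cycles) : A.ev t Z = Z.1 t := rfl

/-- The winding number modulo 2 around the point of the plane just above the arc `s` at the abscissa
`x`, as a linear form on cycles. -/
noncomputable def windAt (s : T) (x : ℝ) : Module.Dual (ZMod 2) A.cycles :=
  ∑ t, ind₂ (A.Above s x t) • A.ev t

lemma windAt_apply (s : T) (x : ℝ) (Z : A.cycles) :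
    A.windAt s x Z = ∑ t, Z.1 t * ind₂ (A.Above s x t) := by
  simp [windAt, LinearMap.sum_apply, mul_comm]

/-- The winding number modulo 2 around the points just above an arc. -/
noncomputable def wind (s : T) : Module.Dual (ZMod 2) A.cycles :=
  A.windAt s (A.exists_generic (A.lt s)).choose

lemma wind_eq {s : T} {x : ℝ} (hx : A.Active x s) (gx : x ∉ A.ends) : A.wind s = A.windAt s x := by
  have h := (A.exists_generic (A.lt s)).choose_spec
  ext Z
  rw [wind, windAt_apply, windAt_apply]
  exact A.sum_above_eq Z.2 s h.1 hx h.2 gx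

/-- The arcs that have the face `f` on exactly one side. -/
noncomputable def bdry (f : Module.Dual (ZMod 2) A.cycles) (s : T) : ZMod 2 :=
  ind₂ (A.wind s = f) + ind₂ (A.wind s + A.ev s = f)

/-- Sorted by decreasing height, the partial sums of `c` run from 0 to the total. Each intermediate
value is counted twice, once after a term and once before the next, so only the two extreme values
survive modulo 2. The induction adds a new lowest element. -/
lemma sum_telescope {ι M : Type*} [AddCommGroup M] (h : ι → ℝ) (c : ι → M) (f : M) (S : Finset ι)
    (hS : Set.InjOn h S) :
    ∑ i ∈ S, (ind₂ (∑ j ∈ S, (open Classical in if h i < h j then c j else 0) = f) +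
      ind₂ (∑ j ∈ S, (open Classical in if h i < h j then c j else 0) + c i = f)) =
      ind₂ (0 = f) + ind₂ (∑ j ∈ S, c j = f) := by
  classical
  induction S using Finset.induction_on_min_value h with
  | empty =>
    have two : ∀ a : ZMod 2, a + a = 0 := by decide
    simp [two]
  | insert a s ha hmin ih =>
    have hs : Set.InjOn h s := hS.mono (by simp)
    have hlt : ∀ x ∈ s, h a < h x := fun x hx => lt_of_le_of_ne (hmin x hx) fun he => by
      have := hS (by simp) (by simp [hx]) he
      exact ha (this ▸ hx)
    rw [Finset.sum_insert ha, Finset.sum_insert ha (f := c)]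
    have e1 : ∑ j ∈ insert a s, (if h a < h j then c j else 0) = ∑ j ∈ s, c j := by
      rw [Finset.sum_insert ha, if_neg (lt_irrefl _), zero_add]
      exact Finset.sum_congr rfl fun j hj => if_pos (hlt j hj)
    have e2 : ∀ i ∈ s, ∑ j ∈ insert a s, (if h i < h j then c j else 0) =
        ∑ j ∈ s, (if h i < h j then c j else 0) := by
      intro i hi
      rw [Finset.sum_insert ha, if_neg (not_lt.mpr (hmin i hi)), zero_add]
    have e3 : ∑ i ∈ s, (ind₂ (∑ j ∈ insert a s, (if h i < h j then c j else 0) = f) +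
        ind₂ (∑ j ∈ insert a s, (if h i < h j then c j else 0) + c i = f)) =
        ind₂ (0 = f) + ind₂ (∑ j ∈ s, c j = f) :=
      (Finset.sum_congr rfl fun i hi => by rw [e2 i hi]).trans (ih hs)
    rw [e1, e3, add_comm (c a)]
    have two : ∀ a b c : ZMod 2, a + b + (c + a) = c + b := by decide
    exact two _ _ _

/-- Going down a generic vertical line, the form changes by `ev t` at each active arc `t`. It starts
at 0 and returns to 0, because every cycle meets the line in an even number of arcs. Hence the line
enters and leaves the face `f` equally often modulo 2. -/
lemma sum_bdry_active (f : Module.Dual (ZMod 2) A.cycles) {x : ℝ} (gx : x ∉ A.ends) :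
    ∑ t, A.bdry f t * ind₂ (A.Active x t) = 0 := by
  classical
  set S : Finset T := Finset.univ.filter (A.Active x) with hS
  have hinj : Set.InjOn (fun t => A.y t x) S := by
    intro s hs t ht he
    by_contra hne
    simp only [hS, Finset.coe_filter, Finset.mem_univ, true_and, Set.mem_ofPred_eq] at hs ht
    exact A.y_ne s t hne x hs ⟨ht.1.le, ht.2.le⟩ he
  have h := sum_telescope (fun t => A.y t x) A.ev f S hinj
  have e0 : ∑ j ∈ S, A.ev j = 0 := by
    ext Z
    have := A.sum_active Z.2 gx
    simp only [LinearMap.sum_apply, ev_apply, LinearMap.zero_apply]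
    rw [← this, hS, Finset.sum_filter]
    exact Finset.sum_congr rfl fun t _ => by by_cases ht : A.Active x t <;> simp [ind₂, ht]
  have two : ∀ a : ZMod 2, a + a = 0 := by decide
  rw [e0, two] at h
  rw [← h, hS, Finset.sum_filter]
  refine Finset.sum_congr rfl fun t _ => ?_
  by_cases ht : A.Active x t
  · have hw : A.wind t = ∑ j ∈ Finset.univ.filter (A.Active x),
        (if A.y t x < A.y j x then A.ev j else 0) := by
      rw [A.wind_eq ht gx, windAt, Finset.sum_filter]
      refine Finset.sum_congr rfl fun j _ => ?_
      by_cases h1 : A.Active x j <;> by_cases h2 : A.y t x < A.y j x <;>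
        simp [ind₂, Above, h1, h2]
    rw [if_pos ht, ← hw, ind₂_true ht, mul_one, bdry]
  · rw [if_neg ht, ind₂_false ht, mul_zero]

/-- The boundary of a face is a cycle. -/
lemma bdry_mem (f : Module.Dual (ZMod 2) A.cycles) : A.bdry f ∈ A.cycles := by
  classical
  intro v
  have hfin : ((A.ends.erase v : Finset ℝ) : Set ℝ)ᶜ ∈ nhds v :=
    (A.ends.erase v).finite_toSet.isClosed.isOpen_compl.mem_nhds (by simp)
  obtain ⟨ε, hε, hball⟩ := Metric.mem_nhds_iff.mp hfin
  have gen : ∀ x, |x - v| < ε → x ≠ v → x ∉ A.ends := fun x hx hxv hmem => by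
    have : x ∈ Metric.ball v ε := by rwa [Metric.mem_ball, Real.dist_eq]
    exact hball this (by simp [hxv, hmem])
  have near : ∀ x ∈ A.ends, v - ε / 2 < x ∧ x < v + ε / 2 ↔ x = v := by
    intro x hx
    constructor
    · rintro ⟨h1, h2⟩
      by_contra hxv
      exact gen x (by rw [abs_lt]; constructor <;> linarith) hxv hx
    · rintro rfl
      constructor <;> linarith
  have g1 : v - ε / 2 ∉ A.ends := gen _ (by rw [abs_lt]; constructor <;> linarith) (by linarith)
  have g2 : v + ε / 2 ∉ A.ends := gen _ (by rw [abs_lt]; constructor <;> linarith) (by linarith)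
  -- Only the abscissa `v` itself carries end points within ε/2, so an arc ends at `v` exactly when
  -- it passes over just one of the two neighbouring generic abscissas.
  have key : ∀ t, ind₂ (A.α t = v) + ind₂ (A.β t = v) =
      ind₂ (A.Active (v - ε / 2) t) + ind₂ (A.Active (v + ε / 2) t) := by
    intro t
    have hl := near _ (A.left_mem t)
    have hr := near _ (A.right_mem t)
    have a1 : A.α t ≠ v - ε / 2 := fun h => g1 (h ▸ A.left_mem t)
    have a2 : A.β t ≠ v - ε / 2 := fun h => g1 (h ▸ A.right_mem t)
    have a3 : A.α t ≠ v + ε / 2 := fun h => g2 (h ▸ A.left_mem t)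
    have a4 : A.β t ≠ v + ε / 2 := fun h => g2 (h ▸ A.right_mem t)
    have hlt := A.lt t
    rw [← ind₂_congr hl, ← ind₂_congr hr]
    unfold Active
    rcases lt_or_gt_of_ne a1 with h1 | h1 <;> rcases lt_or_gt_of_ne a2 with h2 | h2 <;>
      rcases lt_or_gt_of_ne a3 with h3 | h3 <;> rcases lt_or_gt_of_ne a4 with h4 | h4 <;>
      first
      | (exfalso; linarith)
      | (simp only [ind₂, h1, h2, h3, h4, lt_asymm h1, lt_asymm h2, lt_asymm h3, lt_asymm h4,
          and_true, and_false, if_true, if_false]; try decide)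
  simp only [key, mul_add, Finset.sum_add_distrib]
  rw [A.sum_bdry_active f g1, A.sum_bdry_active f g2, add_zero]

open Classical in
/-- The linear forms on cycles that correspond to faces. -/
noncomputable def faces : Finset (Module.Dual (ZMod 2) A.cycles) :=
  Finset.univ.biUnion fun s => if A.ev s = 0 then ∅ else {A.wind s, A.wind s + A.ev s}

lemma mem_faces {f : Module.Dual (ZMod 2) A.cycles} :
    f ∈ A.faces ↔ ∃ s, A.ev s ≠ 0 ∧ (f = A.wind s ∨ f = A.wind s + A.ev s) := by
  classical
  simp only [faces, Finset.mem_biUnion, Finset.mem_univ, true_and]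
  refine exists_congr fun s => ?_
  by_cases h : A.ev s = 0 <;> simp [h]

/-- The condition `A.ev s ≠ 0` in `faces` makes the forms on the two sides of `s` different, so the
arc that witnesses the face lies on its boundary. -/
lemma bdry_ne_zero {f : Module.Dual (ZMod 2) A.cycles} (hf : f ∈ A.faces) : A.bdry f ≠ 0 := by
  obtain ⟨s, hs, h⟩ := A.mem_faces.mp hf
  intro h0
  have := congrFun h0 s
  rcases h with rfl | rfl
  · rw [bdry, ind₂_true rfl, ind₂_false (by simpa using hs)] at this
    simp at this
  · rw [bdry, ind₂_true (p := A.wind s + A.ev s = _) rfl, ind₂_false (by simpa using hs)] at this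
    simp at this

/-- This is the unbounded face: over a generic abscissa, no cycle passes above the highest of the
arcs that lie on cycles. -/
lemma zero_mem_faces (h : A.cycles ≠ ⊥) : 0 ∈ A.faces := by
  classical
  obtain ⟨Z, hZ, hZ0⟩ := Submodule.exists_mem_ne_zero_of_ne_bot h
  obtain ⟨s, hs⟩ := Function.ne_iff.mp hZ0
  obtain ⟨x, hx, gx⟩ := A.exists_generic (A.lt s)
  set S : Finset T := Finset.univ.filter fun t => A.Active x t ∧ A.ev t ≠ 0
  have hs0 : A.ev s ≠ 0 := fun h0 => hs (by simpa using LinearMap.congr_fun h0 ⟨Z, hZ⟩)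
  obtain ⟨t, ht, hmax⟩ := S.exists_max_image (fun t => A.y t x) ⟨s, by simp [S, hs0]; exact hx⟩
  simp only [S, Finset.mem_filter, Finset.mem_univ, true_and] at ht hmax
  refine A.mem_faces.mpr ⟨t, ht.2, Or.inl ?_⟩
  rw [A.wind_eq ht.1 gx, windAt]
  refine (Finset.sum_eq_zero fun j _ => ?_).symm
  by_cases hj : A.ev j = 0
  · rw [hj, smul_zero]
  · rw [ind₂_false, zero_smul]
    exact fun h => absurd h.2 (not_lt.mpr (hmax j ⟨h.1, hj⟩))

/-- A cycle annihilated by the forms on both sides of `s` is annihilated by their difference `ev s`.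
So the nonzero faces already embed the cycle space in a coordinate space, and the face 0 adds one to
the count. -/
lemma finrank_lt_card_faces (h : A.cycles ≠ ⊥) :
    Module.finrank (ZMod 2) A.cycles + 1 ≤ A.faces.card := by
  classical
  have h0 := A.zero_mem_faces h
  rw [← Finset.card_erase_add_one h0]
  refine Nat.add_le_add_right ?_ 1
  let Φ : A.cycles →ₗ[ZMod 2] ((A.faces.erase 0 : Finset _) → ZMod 2) :=
    LinearMap.pi fun f => f.1
  have hinj : Function.Injective Φ := by
    rw [← LinearMap.ker_eq_bot, LinearMap.ker_eq_bot']
    intro Z hZ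
    have hall : ∀ f ∈ A.faces, f Z = 0 := by
      intro f hf
      by_cases hf0 : f = 0
      · simp [hf0]
      · exact congrFun hZ ⟨f, Finset.mem_erase.mpr ⟨hf0, hf⟩⟩
    ext s
    by_cases hs : A.ev s = 0
    · simpa using LinearMap.congr_fun hs Z
    · have h1 := hall _ (A.mem_faces.mpr ⟨s, hs, Or.inl rfl⟩)
      have h2 := hall _ (A.mem_faces.mpr ⟨s, hs, Or.inr rfl⟩)
      rw [LinearMap.add_apply, h1, zero_add] at h2
      simpa using h2
  have := LinearMap.finrank_le_finrank_of_injective hinj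
  simpa using this

/-- If every nonzero cycle has weight at least `g`, then the dimension of the space of cycles is
bounded by Euler's formula. -/
theorem mul_finrank_add_one_le (h : A.cycles ≠ ⊥) (m : T → ℕ) (g : ℕ)
    (hg : ∀ Z ∈ A.cycles, Z ≠ 0 → g ≤ ∑ t, (open Classical in if Z t = 0 then 0 else m t)) :
    g * (Module.finrank (ZMod 2) A.cycles + 1) ≤ 2 * ∑ t, m t := by
  classical
  calc g * (Module.finrank (ZMod 2) A.cycles + 1) ≤ g * A.faces.card :=
        Nat.mul_le_mul_left _ (A.finrank_lt_card_faces h)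
    _ = ∑ f ∈ A.faces, g := by simp [mul_comm]
    _ ≤ ∑ f ∈ A.faces, ∑ t, if A.bdry f t = 0 then 0 else m t :=
        Finset.sum_le_sum fun f hf => by
          convert hg _ (A.bdry_mem f) (A.bdry_ne_zero hf)
    _ = ∑ t, ∑ f ∈ A.faces, if A.bdry f t = 0 then 0 else m t := Finset.sum_comm
    _ ≤ ∑ t, 2 * m t := by
        refine Finset.sum_le_sum fun t _ => ?_
        calc ∑ f ∈ A.faces, (if A.bdry f t = 0 then 0 else m t)
            -- An arc lies on the boundary only of faces found on one of its two sides.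
            ≤ ∑ f ∈ A.faces, if f ∈ ({A.wind t, A.wind t + A.ev t} : Finset _) then m t else 0 := by
              refine Finset.sum_le_sum fun f _ => ?_
              by_cases h1 : A.wind t = f
              · simp [h1]
                split <;> simp
              · by_cases h2 : A.wind t + A.ev t = f
                · simp [h2]
                  split <;> simp
                · simp [bdry, ind₂, h1, h2]
          _ = ((A.faces.filter (· ∈ ({A.wind t, A.wind t + A.ev t} : Finset _))).card) * m t := by
              rw [← Finset.sum_filter, Finset.sum_const, smul_eq_mul]
          _ ≤ 2 * m t := by
              refine Nat.mul_le_mul_right _ (le_trans (Finset.card_le_card ?_)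
                (Finset.card_le_two (a := A.wind t) (b := A.wind t + A.ev t)))
              intro f hf
              exact (Finset.mem_filter.mp hf).2
    _ = 2 * ∑ t, m t := by rw [Finset.mul_sum]

end ArcSystem

/-! ### The cycle space of a graph modulo 2. -/

namespace SimpleGraph

/-- Each passage through `w` uses two edges, so modulo 2 only the ends of the walk count. -/
lemma Walk.sum_edges_ind₂ {V : Type*} {G : SimpleGraph V} {u v : V} (p : G.Walk u v) (w : V) :
    (p.edges.map fun e => ind₂ (w ∈ e)).sum = ind₂ (w = u) + ind₂ (w = v) := by
  have two : ∀ a : ZMod 2, a + a = 0 := by decide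
  induction p with
  | nil => simp [two]
  | @cons u x v h p ih =>
    have h1 : ind₂ (w ∈ s(u, x)) = ind₂ (w = u) + ind₂ (w = x) := by
      have := G.ne_of_adj h
      by_cases hu : w = u
      · subst hu
        simp [ind₂, this]
      · by_cases hx : w = x <;> simp [ind₂, hu, hx]
        exact fun h => this h.symm
    rw [Walk.edges_cons, List.map_cons, List.sum_cons, ih, h1]
    have three : ∀ a b c : ZMod 2, a + b + (b + c) = a + c := by decide
    exact three _ _ _

variable {V : Type*} (G : SimpleGraph V) [Fintype G.edgeSet]

/-- The boundary operator modulo 2. -/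
noncomputable def boundaryMod2 : (G.edgeSet → ZMod 2) →ₗ[ZMod 2] (V → ZMod 2) where
  toFun c w := ∑ e, c e * ind₂ (w ∈ e.1)
  map_add' c c' := by
    ext w
    simp [add_mul, Finset.sum_add_distrib]
  map_smul' a c := by
    ext w
    simp [mul_assoc, Finset.mul_sum]

lemma boundaryMod2_apply (c : G.edgeSet → ZMod 2) (w : V) :
    G.boundaryMod2 c w = ∑ e, c e * ind₂ (w ∈ e.1) := rfl

/-- The edge set of a cycle is a nonzero element of the kernel of the boundary operator. -/
lemma ker_boundaryMod2_ne_bot {G : SimpleGraph V} [Fintype G.edgeSet] (h : ¬ G.IsAcyclic) : LinearMap.ker G.boundaryMod2 ≠ ⊥ := by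
  classical
  rw [IsAcyclic] at h
  push Not at h
  obtain ⟨v, p, hp⟩ := h
  rw [Submodule.ne_bot_iff]
  refine ⟨fun e => ind₂ (e.1 ∈ p.edges), ?_, ?_⟩
  · rw [LinearMap.mem_ker]
    ext w
    have two : ∀ a : ZMod 2, a + a = 0 := by decide
    have h1 := p.sum_edges_ind₂ w
    rw [two, ← List.sum_toFinset _ hp.edges_nodup] at h1
    rw [boundaryMod2_apply, Pi.zero_apply, ← h1]
    have h2 : p.edges.toFinset = (Finset.univ.filter fun e : G.edgeSet => e.1 ∈ p.edges).map
        (Function.Embedding.subtype _) := by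
      ext e
      simp only [List.mem_toFinset, Finset.mem_map, Finset.mem_filter, Finset.mem_univ, true_and,
        Function.Embedding.subtype_apply, Subtype.exists, exists_and_left, exists_prop,
        exists_eq_right_right]
      exact ⟨fun he => ⟨he, p.edges_subset_edgeSet he⟩, fun he => he.1⟩
    rw [h2, Finset.sum_map, Finset.sum_filter]
    exact Finset.sum_congr rfl fun e _ => by
      by_cases he : e.1 ∈ p.edges <;> simp [he, ind₂_true, ind₂_false]
  · intro h0
    cases p with
    | nil => exact hp.not_nil Walk.nil_nil
    | cons h p =>
      have := congrFun h0 ⟨s(_, _), h⟩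
      rw [ind₂_true (by simp)] at this
      simp at this

variable [Fintype V]

lemma sum_ind₂_mem {x y : V} (hxy : x ≠ y) (f : V → ZMod 2) :
    ∑ w, f w * ind₂ (w ∈ s(x, y)) = f x + f y := by
  classical
  have : ∀ w, f w * ind₂ (w ∈ s(x, y)) = (if w = x then f w else 0) + if w = y then f w else 0 := by
    intro w
    by_cases hx : w = x
    · subst hx
      simp [ind₂, hxy]
    · by_cases hy : w = y <;> simp [ind₂, hx, hy]
      exact fun h => absurd h hxy.symm
  rw [Finset.sum_congr rfl fun w _ => this w]
  simp [Finset.sum_add_distrib]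

/-- Adjointness of boundary and coboundary. It serves for `f` constant, for the indicator of a
component, and for the indicator of the vertices with a given abscissa. -/
lemma sum_mul_boundaryMod2 (c : G.edgeSet → ZMod 2) (f : V → ZMod 2) :
    ∑ w, f w * G.boundaryMod2 c w = ∑ e, c e * ∑ w, f w * ind₂ (w ∈ e.1) := by
  simp only [boundaryMod2_apply, Finset.mul_sum]
  rw [Finset.sum_comm]
  exact Finset.sum_congr rfl fun e _ => Finset.sum_congr rfl fun w _ => by ring

/-- Every boundary has coordinate sum 0, so the boundary operator has rank at most |V| - 1; then
rank-nullity applies. -/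
lemma card_edgeSet_add_one_le [Nonempty V] :
    Fintype.card G.edgeSet + 1 ≤
      Module.finrank (ZMod 2) (LinearMap.ker G.boundaryMod2) + Fintype.card V := by
  classical
  let S : (V → ZMod 2) →ₗ[ZMod 2] ZMod 2 := ∑ w, LinearMap.proj w
  have hS : ∀ f, S f = ∑ w, f w := fun f => by simp [S]
  have h1 : LinearMap.range G.boundaryMod2 ≤ LinearMap.ker S := by
    rintro _ ⟨c, rfl⟩
    rw [LinearMap.mem_ker, hS]
    have h := G.sum_mul_boundaryMod2 c (fun _ => 1)
    simp only [one_mul] at h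
    rw [h]
    refine Finset.sum_eq_zero fun ⟨e, he⟩ _ => ?_
    induction e with
    | h x y =>
      have := sum_ind₂_mem (G.ne_of_adj he) (fun _ => (1 : ZMod 2))
      simp only [one_mul] at this
      rw [this]
      have : (1 + 1 : ZMod 2) = 0 := by decide
      rw [this, mul_zero]
  have h2 : Function.Surjective S := fun a => by
    refine ⟨Pi.single (Classical.arbitrary V) a, ?_⟩
    rw [hS]
    simp
  have h3 := Submodule.finrank_mono h1
  have h4 := LinearMap.finrank_range_add_finrank_ker S
  have h5 := LinearMap.finrank_range_add_finrank_ker G.boundaryMod2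
  rw [LinearMap.range_eq_top.mpr h2, finrank_top, Module.finrank_self,
    Module.finrank_fintype_fun_eq_card] at h4
  rw [Module.finrank_fintype_fun_eq_card] at h5
  omega

variable {G}

/-- The support of a nonzero cycle modulo 2 contains a cycle. -/
lemma exists_isCycle_of_boundaryMod2_eq_zero {c : G.edgeSet → ZMod 2} (hc : G.boundaryMod2 c = 0)
    (hc0 : c ≠ 0) : ∃ (v : V) (p : G.Walk v v), p.IsCycle ∧
      p.length ≤ ∑ e, (open Classical in if c e = 0 then 0 else 1) := by
  classical
  let F : Set (Sym2 V) := {e | ∃ h : e ∈ G.edgeSet, c ⟨e, h⟩ ≠ 0}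
  let H : SimpleGraph V := fromEdgeSet F
  have hH : ∀ x y, H.Adj x y ↔ ∃ h : G.Adj x y, c ⟨s(x, y), h⟩ ≠ 0 := by
    intro x y
    simp only [H, F, fromEdgeSet_adj, Set.mem_ofPred_eq, mem_edgeSet]
    exact ⟨fun h => h.1, fun h => ⟨h, G.ne_of_adj h.1⟩⟩
  have hHG : H ≤ G := fun x y h => ((hH x y).mp h).1
  have hcyc : ¬ H.IsAcyclic := by
    rw [isAcyclic_iff_forall_adj_isBridge]
    intro hall
    obtain ⟨⟨e, he⟩, hce⟩ := Function.ne_iff.mp hc0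
    induction e with
    | h u v =>
      have hb := hall ((hH u v).mpr ⟨he, hce⟩)
      rw [isBridge_iff] at hb
      -- If an edge uv of the support were a bridge, the boundary of `c` summed over the side `K` of
      -- u would count uv alone: every other edge of the support has both ends or neither in `K`.
      let K : V → Prop := fun w => (H.deleteEdges {s(u, v)}).Reachable u w
      have hsum := G.sum_mul_boundaryMod2 c (fun w => ind₂ (K w))
      rw [hc] at hsum
      simp only [Pi.zero_apply, mul_zero, Finset.sum_const_zero] at hsum
      rw [Finset.sum_eq_single ⟨s(u, v), he⟩] at hsum
      · simp only at hsum
        rw [sum_ind₂_mem (G.ne_of_adj he), ind₂_true (Reachable.refl u), ind₂_false hb, add_zero,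
          mul_one] at hsum
        exact hce hsum.symm
      · rintro ⟨f, hf⟩ - hne
        induction f with
        | h x y =>
          by_cases hcf : c ⟨s(x, y), hf⟩ = 0
          · rw [hcf, zero_mul]
          · have hadj : (H.deleteEdges {s(u, v)}).Adj x y := by
              rw [deleteEdges_adj]
              exact ⟨(hH x y).mpr ⟨hf, hcf⟩, fun h => hne (Subtype.ext h)⟩
            have hK : K x ↔ K y :=
              ⟨fun h => h.trans hadj.reachable, fun h => h.trans hadj.symm.reachable⟩
            have two : ∀ a : ZMod 2, a + a = 0 := by decide
            rw [sum_ind₂_mem (G.ne_of_adj hf), ind₂_congr hK, two, mul_zero]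
      · simp
  rw [IsAcyclic] at hcyc
  push Not at hcyc
  obtain ⟨v, p, hp⟩ := hcyc
  refine ⟨v, p.mapLe hHG, hp.mapLe hHG, ?_⟩
  rw [Walk.length_map, ← Walk.length_edges, ← List.toFinset_card_of_nodup hp.edges_nodup]
  have : p.edges.toFinset ⊆
      (Finset.univ.filter fun e : G.edgeSet => c e ≠ 0).map (Function.Embedding.subtype _) := by
    intro e he
    have := p.edges_subset_edgeSet (List.mem_toFinset.mp he)
    induction e with
    | h x y =>
      obtain ⟨h1, h2⟩ := (hH x y).mp this
      simp only [Finset.mem_map, Finset.mem_filter, Finset.mem_univ, true_and]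
      exact ⟨⟨s(x, y), h1⟩, h2, rfl⟩
  refine (Finset.card_le_card this).trans ?_
  rw [Finset.card_map, Finset.card_filter]
  exact Finset.sum_le_sum fun e _ => by by_cases h : c e = 0 <;> simp [h]

lemma not_isAcyclic_of_card_le [Nonempty V] (h : Fintype.card V ≤ Fintype.card G.edgeSet) :
    ¬ G.IsAcyclic := by
  have h1 := G.card_edgeSet_add_one_le
  have h2 : LinearMap.ker G.boundaryMod2 ≠ ⊥ := by
    intro h0
    rw [h0, finrank_bot] at h1
    omega
  obtain ⟨c, hc, hc0⟩ := Submodule.exists_mem_ne_zero_of_ne_bot h2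
  obtain ⟨v, p, hp, -⟩ := exists_isCycle_of_boundaryMod2_eq_zero hc hc0
  exact fun hG => hG p hp

lemma girth_le_sum_of_boundaryMod2_eq_zero {c : G.edgeSet → ZMod 2} (hc : G.boundaryMod2 c = 0)
    (hc0 : c ≠ 0) : G.girth ≤ ∑ e, (open Classical in if c e = 0 then 0 else 1) := by
  obtain ⟨v, p, hp, h⟩ := exists_isCycle_of_boundaryMod2_eq_zero hc hc0
  exact (girth_le_length hp).trans h

end SimpleGraph

/-! ### Incidences between the segments of a plane drawing. -/

/-- The points `pt 0, …, pt m` are the vertices of a simple polygonal arc. -/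
structure IsSimplePolyline (m : ℕ) (pt : ℕ → ℝ × ℝ) : Prop where
  pos : 0 < m
  ne : ∀ i < m, pt i ≠ pt (i + 1)
  consecutive : ∀ i, i + 1 < m →
    segment ℝ (pt i) (pt (i + 1)) ∩ segment ℝ (pt (i + 1)) (pt (i + 2)) = {pt (i + 1)}
  disjoint : ∀ i j, i + 1 < j → j < m →
    Disjoint (segment ℝ (pt i) (pt (i + 1))) (segment ℝ (pt j) (pt (j + 1)))

namespace IsSimplePolyline

variable {m : ℕ} {pt : ℕ → ℝ × ℝ} (h : IsSimplePolyline m pt)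
include h

lemma ne_of_lt {i j : ℕ} (hij : i < j) (hj : j ≤ m) : pt i ≠ pt j := by
  intro he
  obtain ⟨j, rfl⟩ : ∃ k, j = k + 1 := ⟨j - 1, by omega⟩
  have h1 := left_mem_segment ℝ (pt i) (pt (i + 1))
  have h2 := right_mem_segment ℝ (pt j) (pt (j + 1))
  rcases lt_trichotomy j i with hji | rfl | hji
  · omega
  · exact h.ne j (by omega) he
  rcases eq_or_lt_of_le (Nat.succ_le_of_lt hji) with hji | hji
  · have : pt i ∈ ({pt (i + 1)} : Set _) := by
      rw [← h.consecutive i (by omega)]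
      refine ⟨h1, ?_⟩
      rw [he, show i + 2 = j + 1 by omega, show i + 1 = j by omega]
      exact h2
    exact h.ne i (by omega) this
  · exact Set.disjoint_left.mp (h.disjoint i j hji (by omega)) h1 (he ▸ h2)

lemma injective {i j : ℕ} (hi : i ≤ m) (hj : j ≤ m) (he : pt i = pt j) : i = j := by
  rcases lt_trichotomy i j with hij | hij | hij
  · exact absurd he (h.ne_of_lt hij hj)
  · exact hij
  · exact absurd he.symm (h.ne_of_lt hij hi)

lemma eq_or_eq_of_mem {i j : ℕ} (hi : i < m) (hj : j ≤ m)
    (hmem : pt j ∈ segment ℝ (pt i) (pt (i + 1))) : j = i ∨ j = i + 1 := by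
  rcases lt_trichotomy j i with hji | hji | hji
  · exfalso
    have h1 := left_mem_segment ℝ (pt j) (pt (j + 1))
    rcases eq_or_lt_of_le (Nat.succ_le_of_lt hji) with h2 | h2
    · obtain rfl : j + 1 = i := h2
      have : pt j ∈ ({pt (j + 1)} : Set _) := by
        rw [← h.consecutive j (by omega)]
        exact ⟨h1, hmem⟩
      exact h.ne j (by omega) this
    · exact Set.disjoint_left.mp (h.disjoint j i h2 hi) h1 hmem
  · exact Or.inl hji
  · right
    by_contra hne
    obtain ⟨j, rfl⟩ : ∃ k, j = k + 1 := ⟨j - 1, by omega⟩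
    have h1 := right_mem_segment ℝ (pt j) (pt (j + 1))
    rcases eq_or_lt_of_le (show i + 1 ≤ j by omega) with h2 | h2
    · subst h2
      have : pt (i + 1 + 1) ∈ ({pt (i + 1)} : Set _) := by
        rw [← h.consecutive i (by omega)]
        exact ⟨hmem, h1⟩
      exact h.ne (i + 1) (by omega) (Set.mem_singleton_iff.mp this).symm
    · exact Set.disjoint_left.mp (h.disjoint i j h2 (by omega)) hmem h1

lemma mem_pair_of_mem_inter {i j : ℕ} (hij : i ≠ j) (hi : i < m) (hj : j < m) {z : ℝ × ℝ}
    (hzi : z ∈ segment ℝ (pt i) (pt (i + 1))) (hzj : z ∈ segment ℝ (pt j) (pt (j + 1))) :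
    z = pt i ∨ z = pt (i + 1) := by
  rcases lt_trichotomy i j with hlt | hlt | hlt
  · rcases eq_or_lt_of_le (Nat.succ_le_of_lt hlt) with h2 | h2
    · obtain rfl : i + 1 = j := h2
      have : z ∈ ({pt (i + 1)} : Set _) := by
        rw [← h.consecutive i (by omega)]
        exact ⟨hzi, hzj⟩
      exact Or.inr this
    · exact (Set.disjoint_left.mp (h.disjoint i j h2 hj) hzi hzj).elim
  · exact (hij hlt).elim
  · rcases eq_or_lt_of_le (Nat.succ_le_of_lt hlt) with h2 | h2
    · obtain rfl : j + 1 = i := h2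
      have : z ∈ ({pt (j + 1)} : Set _) := by
        rw [← h.consecutive j (by omega)]
        exact ⟨hzj, hzi⟩
      exact Or.inl this
    · exact (Set.disjoint_left.mp (h.disjoint j i h2 hi) hzj hzi).elim

end IsSimplePolyline

namespace PlaneDrawing

variable {V : Type*} {G : SimpleGraph V}

/-- A choice of vertices for the polygonal arcs of a plane drawing. -/
structure Polylines (D : PlaneDrawing G) where
  fst : G.edgeSet → V
  snd : G.edgeSet → V
  m : G.edgeSet → ℕ
  pt : G.edgeSet → ℕ → ℝ × ℝ
  eq_mk : ∀ e, e.1 = s(fst e, snd e)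
  pt_zero : ∀ e, pt e 0 = D.pos (fst e)
  pt_last : ∀ e, pt e (m e) = D.pos (snd e)
  simple : ∀ e, IsSimplePolyline (m e) (pt e)
  curve_eq : ∀ e, D.curve e.1 = ⋃ i ∈ Set.Iio (m e), segment ℝ (pt e i) (pt e (i + 1))

lemma nonempty_polylines (D : PlaneDrawing G) : Nonempty (Polylines D) := by
  have h : ∀ e : G.edgeSet, ∃ (u v : V) (m : ℕ) (pt : ℕ → ℝ × ℝ), e.1 = s(u, v) ∧
      pt 0 = D.pos u ∧ pt m = D.pos v ∧ IsSimplePolyline m pt ∧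
      D.curve e.1 = ⋃ i ∈ Set.Iio m, segment ℝ (pt i) (pt (i + 1)) := by
    rintro ⟨e, he⟩
    induction e with
    | h u v =>
      obtain ⟨m, pt, hm, h0, h1, h2, h3, h4, h5⟩ := D.isPolygonalArc u v he
      exact ⟨u, v, m, pt, rfl, h0, h1, ⟨hm, h2, h3, h4⟩, h5⟩
  choose u v m pt h0 h1 h2 h3 h4 using h
  exact ⟨⟨u, v, m, pt, h0, h1, h2, h3, h4⟩⟩

namespace Polylines

variable {D : PlaneDrawing G} (P : Polylines D)

lemma segment_subset {e : G.edgeSet} {i : ℕ} (hi : i < P.m e) :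
    segment ℝ (P.pt e i) (P.pt e (i + 1)) ⊆ D.curve e.1 := by
  rw [P.curve_eq]
  exact Set.subset_biUnion_of_mem (u := fun i => segment ℝ (P.pt e i) (P.pt e (i + 1))) hi

lemma pt_mem_curve {e : G.edgeSet} {i : ℕ} (hi : i ≤ P.m e) : P.pt e i ∈ D.curve e.1 := by
  have h0 := (P.simple e).pos
  rcases eq_or_lt_of_le hi with rfl | hi
  · obtain ⟨k, hk⟩ : ∃ k, P.m e = k + 1 := ⟨P.m e - 1, by omega⟩
    rw [hk]
    exact P.segment_subset (by omega) (right_mem_segment ℝ _ _)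
  · exact P.segment_subset hi (left_mem_segment ℝ _ _)

lemma eq_zero_or_eq_last {e e' : G.edgeSet} (hne : e ≠ e') {z : ℝ × ℝ} (hz : z ∈ D.curve e.1)
    (hz' : z ∈ D.curve e'.1) : z = P.pt e 0 ∨ z = P.pt e (P.m e) := by
  obtain ⟨w, ⟨hw, -⟩, rfl⟩ := D.inter_subset e.1 e.2 e'.1 e'.2 (fun h => hne (Subtype.ext h))
    ⟨hz, hz'⟩
  rw [P.eq_mk, Sym2.mem_iff] at hw
  rw [P.pt_zero, P.pt_last]
  rcases hw with rfl | rfl <;> simp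

/-- Distinct edges meet only at ends of both, so an inner breakpoint belongs to a single edge.
Consequently just two segments end there, which `exists_eq_comp_fst` needs. -/
lemma eq_of_pt_eq {e e' : G.edgeSet} {j j' : ℕ} (h0 : 0 < j) (h1 : j < P.m e) (h' : j' ≤ P.m e')
    (he : P.pt e' j' = P.pt e j) : e' = e ∧ j' = j := by
  by_cases hee : e' = e
  · subst hee
    exact ⟨rfl, (P.simple e').injective h' h1.le he⟩
  · exfalso
    rcases P.eq_zero_or_eq_last (Ne.symm hee) (P.pt_mem_curve h1.le) (he ▸ P.pt_mem_curve h')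
      with h | h
    · have := (P.simple e).injective h1.le (Nat.zero_le _) h
      omega
    · have := (P.simple e).injective h1.le le_rfl h
      omega

/-- Two different segments of the drawing meet only at end points. -/
lemma mem_pair_of_mem_inter {e e' : G.edgeSet} {i i' : ℕ} (hi : i < P.m e) (hi' : i' < P.m e')
    (hne : e = e' → i ≠ i') {z : ℝ × ℝ} (hz : z ∈ segment ℝ (P.pt e i) (P.pt e (i + 1)))
    (hz' : z ∈ segment ℝ (P.pt e' i') (P.pt e' (i' + 1))) :
    z = P.pt e i ∨ z = P.pt e (i + 1) := by
  by_cases hee : e = e'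
  · subst hee
    exact (P.simple e).mem_pair_of_mem_inter (hne rfl) hi hi' hz hz'
  · rcases P.eq_zero_or_eq_last hee (P.segment_subset hi hz) (P.segment_subset hi' hz')
      with rfl | rfl
    · rcases (P.simple e).eq_or_eq_of_mem hi (Nat.zero_le _) hz with h | h
      · exact Or.inl (by rw [← h])
      · omega
    · rcases (P.simple e).eq_or_eq_of_mem hi le_rfl hz with h | h
      · omega
      · exact Or.inr (by rw [← h])

end Polylines

end PlaneDrawing

/-! ### From a drawing to an arc system. -/

/-- Some linear form is injective on a given finite set of points of the plane. -/
lemma exists_injOn_add_mul (S : Finset (ℝ × ℝ)) :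
    ∃ θ : ℝ, Set.InjOn (fun p : ℝ × ℝ => p.1 + θ * p.2) S := by
  classical
  -- Two points with different ordinates have the same image for a single value of θ; these finitely
  -- many values are avoided.
  obtain ⟨θ, hθ⟩ := Infinite.exists_notMem_finset
    ((S ×ˢ S).image fun r => (r.2.1 - r.1.1) / (r.1.2 - r.2.2))
  refine ⟨θ, fun p hp q hq h => ?_⟩
  simp only at h
  by_cases h2 : p.2 = q.2
  · exact Prod.ext (by rw [h2] at h; linarith) h2
  · exfalso
    refine hθ (Finset.mem_image.mpr ⟨(p, q), Finset.mem_product.mpr ⟨hp, hq⟩, ?_⟩)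
    simp only
    rw [div_eq_iff (sub_ne_zero.mpr h2)]
    linarith

/-- The point of the line through `p` and `q` on which `r ↦ r.1 + θ * r.2` has the value `x`, is
given by its ordinate. -/
noncomputable def lineHeight (θ : ℝ) (p q : ℝ × ℝ) (x : ℝ) : ℝ :=
  p.2 + (x - (p.1 + θ * p.2)) / (q.1 + θ * q.2 - (p.1 + θ * p.2)) * (q.2 - p.2)

lemma lineHeight_mem_segment {θ : ℝ} {p q : ℝ × ℝ} (hpq : p.1 + θ * p.2 ≠ q.1 + θ * q.2) {x : ℝ}
    (h1 : min (p.1 + θ * p.2) (q.1 + θ * q.2) ≤ x) (h2 : x ≤ max (p.1 + θ * p.2) (q.1 + θ * q.2)) :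
    (x - θ * lineHeight θ p q x, lineHeight θ p q x) ∈ segment ℝ p q := by
  set a := p.1 + θ * p.2 with ha
  set b := q.1 + θ * q.2 with hb
  have hab : b - a ≠ 0 := sub_ne_zero.mpr (Ne.symm hpq)
  rw [segment_eq_image]
  refine ⟨(x - a) / (b - a), ?_, ?_⟩
  · rcases lt_or_gt_of_ne hpq with h | h
    · rw [min_eq_left h.le] at h1
      rw [max_eq_right h.le] at h2
      exact ⟨div_nonneg (by linarith) (by linarith), (div_le_one (by linarith)).mpr (by linarith)⟩
    · rw [min_eq_right h.le] at h1
      rw [max_eq_left h.le] at h2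
      exact ⟨div_nonneg_of_nonpos (by linarith) (by linarith),
        (div_le_one_of_neg (by linarith)).mpr (by linarith)⟩
  · have hx : x = a + (x - a) / (b - a) * (b - a) := by field_simp; ring
    simp only [lineHeight, ← ha, ← hb]
    generalize (x - a) / (b - a) = r at hx
    ext
    · simp only [Prod.fst_add, Prod.smul_fst, smul_eq_mul]
      rw [hx, ha, hb]
      ring
    · simp only [Prod.snd_add, Prod.smul_snd, smul_eq_mul]
      ring

lemma ind₂_min_add_max (a b v : ℝ) :
    ind₂ (min a b = v) + ind₂ (max a b = v) = ind₂ (a = v) + ind₂ (b = v) := by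
  rcases le_total a b with h | h
  · rw [min_eq_left h, max_eq_right h]
  · rw [min_eq_right h, max_eq_left h, add_comm]

namespace PlaneDrawing.Polylines

variable {V : Type*} {G : SimpleGraph V} {D : PlaneDrawing G} (P : Polylines D)

/-- The segments of the drawing. -/
abbrev Seg : Type _ := Σ e : G.edgeSet, Fin (P.m e)

/-- The first end of a segment. -/
def src (t : P.Seg) : ℝ × ℝ := P.pt t.1 t.2

/-- The second end of a segment. -/
def tgt (t : P.Seg) : ℝ × ℝ := P.pt t.1 (t.2 + 1)

/-- The segments of a drawing form an arc system, in suitable coordinates. -/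
lemma exists_arcSystem [Finite V] [Finite G.edgeSet] :
    ∃ (θ : ℝ) (A : ArcSystem P.Seg),
      (∀ e e' i i', i ≤ P.m e → i' ≤ P.m e' →
        (P.pt e i).1 + θ * (P.pt e i).2 = (P.pt e' i').1 + θ * (P.pt e' i').2 →
        P.pt e i = P.pt e' i') ∧
      (∀ w w', (D.pos w).1 + θ * (D.pos w).2 = (D.pos w').1 + θ * (D.pos w').2 → w = w') ∧
      ∀ t v, ind₂ (A.α t = v) + ind₂ (A.β t = v) =
        ind₂ ((P.src t).1 + θ * (P.src t).2 = v) + ind₂ ((P.tgt t).1 + θ * (P.tgt t).2 = v) := by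
  classical
  have := Fintype.ofFinite G.edgeSet
  have := Fintype.ofFinite V
  let S : Finset (ℝ × ℝ) := (Finset.univ.biUnion fun e =>
    (Finset.range (P.m e + 1)).image (P.pt e)) ∪ Finset.univ.image D.pos
  have hS : ∀ e i, i ≤ P.m e → P.pt e i ∈ S := fun e i hi =>
    Finset.mem_union_left _ (Finset.mem_biUnion.mpr ⟨e, Finset.mem_univ _,
      Finset.mem_image.mpr ⟨i, Finset.mem_range.mpr (by omega), rfl⟩⟩)
  have hS' : ∀ w, D.pos w ∈ S := fun w =>
    Finset.mem_union_right _ (Finset.mem_image_of_mem _ (Finset.mem_univ w))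
  obtain ⟨θ, hθ⟩ := exists_injOn_add_mul S
  let lam : ℝ × ℝ → ℝ := fun p => p.1 + θ * p.2
  have hsrc : ∀ t, P.src t ∈ S := fun t => hS _ _ t.2.2.le
  have htgt : ∀ t, P.tgt t ∈ S := fun t => hS _ _ t.2.2
  have hne : ∀ t, lam (P.src t) ≠ lam (P.tgt t) := fun t h =>
    (P.simple t.1).ne t.2 t.2.2 (hθ (hsrc t) (htgt t) h)
  -- Well determined on the image of `S`, since the form `lam` is injective there.
  let η : ℝ → ℝ := fun v => (Function.invFunOn lam S v).2
  have hη : ∀ p ∈ S, η (lam p) = p.2 := fun p hp => by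
    simp only [η]
    rw [hθ.leftInvOn_invFunOn hp]
  have hl : ∀ p q, lineHeight θ p q (lam p) = p.2 := fun p q => by simp [lineHeight, lam]
  have hr : ∀ p q, lam p ≠ lam q → lineHeight θ p q (lam q) = q.2 := fun p q h => by
    have : lam q - lam p ≠ 0 := sub_ne_zero.mpr (Ne.symm h)
    simp only [lineHeight]
    change p.2 + (lam q - lam p) / (lam q - lam p) * (q.2 - p.2) = q.2
    rw [div_self this]
    ring
  refine ⟨θ, {
    α := fun t => min (lam (P.src t)) (lam (P.tgt t))
    β := fun t => max (lam (P.src t)) (lam (P.tgt t))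
    y := fun t => lineHeight θ (P.src t) (P.tgt t)
    η := η
    lt := fun t => min_lt_max.mpr (hne t)
    continuous := fun t => by unfold lineHeight; fun_prop
    y_left := fun t => by
      rcases min_choice (lam (P.src t)) (lam (P.tgt t)) with h | h <;> rw [h]
      · rw [hl, hη _ (hsrc t)]
      · rw [hr _ _ (hne t), hη _ (htgt t)]
    y_right := fun t => by
      rcases max_choice (lam (P.src t)) (lam (P.tgt t)) with h | h <;> rw [h]
      · rw [hl, hη _ (hsrc t)]
      · rw [hr _ _ (hne t), hη _ (htgt t)]
    y_ne := ?_ }, ?_, ?_, ?_⟩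
  · intro s t hst x hx hx' he
    have h1 := lineHeight_mem_segment (hne s) hx.1.le hx.2.le
    have h2 := lineHeight_mem_segment (hne t) hx'.1 hx'.2
    rw [← he] at h2
    -- A common point of two segments is an end of `s`, whereas `x` is strictly between the
    -- abscissas of those ends.
    have h3 := P.mem_pair_of_mem_inter s.2.2 t.2.2 (fun h1 h2 => hst ?_) h1 h2
    · have hx0 : lam (x - θ * lineHeight θ (P.src s) (P.tgt s) x,
        lineHeight θ (P.src s) (P.tgt s) x) = x := by simp [lam]
      rcases h3 with h3 | h3
      · have h4 : lam (P.src s) = x := by rw [← hx0, h3]; rfl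
        rcases le_total (lam (P.src s)) (lam (P.tgt s)) with h | h
        · have := hx.1
          rw [min_eq_left h] at this
          exact this.ne h4
        · have := hx.2
          rw [max_eq_left h] at this
          exact this.ne h4.symm
      · have h4 : lam (P.tgt s) = x := by rw [← hx0, h3]; rfl
        rcases le_total (lam (P.src s)) (lam (P.tgt s)) with h | h
        · have := hx.2
          rw [max_eq_right h] at this
          exact this.ne h4.symm
        · have := hx.1
          rw [min_eq_right h] at this
          exact this.ne h4
    · obtain ⟨e, i⟩ := s
      obtain ⟨e', i'⟩ := t
      obtain rfl : e = e' := h1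
      have hi : i = i' := Fin.ext h2
      rw [hi]
  · exact fun e e' i i' hi hi' h => hθ (hS _ _ hi) (hS _ _ hi') h
  · exact fun w w' h => D.pos_injective (hθ (hS' w) (hS' w') h)
  · exact fun t v => ind₂_min_add_max _ _ _

end PlaneDrawing.Polylines

/-! ### Euler's inequality for plane drawings. -/

namespace PlaneDrawing

variable {V : Type*} {G : SimpleGraph V}

namespace Polylines

variable {D : PlaneDrawing G} (P : Polylines D)

lemma sum_range_add_succ (F : ℕ → ZMod 2) (m : ℕ) :
    ∑ i : Fin m, (F i + F (i + 1)) = F 0 + F m := by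
  have two : ∀ a : ZMod 2, a + a = 0 := by decide
  rw [Fin.sum_univ_eq_sum_range (fun i => F i + F (i + 1))]
  induction m with
  | zero => simp [two]
  | succ m ih =>
    rw [Finset.sum_range_succ, ih]
    have three : ∀ a b c : ZMod 2, a + b + (b + c) = a + c := by decide
    exact three _ _ _

variable [Fintype G.edgeSet]

/-- Spread over the segments of its edges, a chain keeps its boundary: along each edge the inner
breakpoints cancel in pairs. -/
lemma sum_lift [Fintype V] (θ : ℝ) (c : G.edgeSet → ZMod 2) (v : ℝ) :
    ∑ t : P.Seg, c t.1 * (ind₂ ((P.src t).1 + θ * (P.src t).2 = v) +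
      ind₂ ((P.tgt t).1 + θ * (P.tgt t).2 = v)) =
    ∑ w, ind₂ ((D.pos w).1 + θ * (D.pos w).2 = v) * G.boundaryMod2 c w := by
  rw [SimpleGraph.sum_mul_boundaryMod2, Fintype.sum_sigma]
  refine Finset.sum_congr rfl fun e _ => ?_
  have hne : P.fst e ≠ P.snd e := by
    have := e.2
    rw [P.eq_mk] at this
    exact G.ne_of_adj this
  have h := SimpleGraph.sum_ind₂_mem hne fun w => ind₂ ((D.pos w).1 + θ * (D.pos w).2 = v)
  rw [← P.eq_mk] at h
  rw [h, ← P.pt_zero, ← P.pt_last,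
    ← sum_range_add_succ (fun i => ind₂ ((P.pt e i).1 + θ * (P.pt e i).2 = v)), Finset.mul_sum]
  rfl

/-- A cycle modulo 2 in the system of segments is constant along each edge of the graph. -/
lemma exists_eq_comp_fst {θ : ℝ} {Z : P.Seg → ZMod 2}
    (hθ : ∀ e e' i i', i ≤ P.m e → i' ≤ P.m e' →
        (P.pt e i).1 + θ * (P.pt e i).2 = (P.pt e' i').1 + θ * (P.pt e' i').2 →
        P.pt e i = P.pt e' i')
    (hZ : ∀ v, ∑ t, Z t * (ind₂ ((P.src t).1 + θ * (P.src t).2 = v) +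
      ind₂ ((P.tgt t).1 + θ * (P.tgt t).2 = v)) = 0) :
    ∃ c : G.edgeSet → ZMod 2, Z = fun t => c t.1 := by
  classical
  -- At an inner breakpoint only two segments end, so the vanishing of the boundary there equates
  -- their coefficients.
  have step : ∀ e i (h : i + 1 < P.m e), Z ⟨e, ⟨i + 1, h⟩⟩ = Z ⟨e, ⟨i, by omega⟩⟩ := by
    intro e i h
    have hs := hZ ((P.pt e (i + 1)).1 + θ * (P.pt e (i + 1)).2)
    have h1 : ∀ t : P.Seg, ind₂ ((P.src t).1 + θ * (P.src t).2 =
        (P.pt e (i + 1)).1 + θ * (P.pt e (i + 1)).2) = if t = ⟨e, ⟨i + 1, h⟩⟩ then 1 else 0 := by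
      intro t
      split
      · rename_i ht
        subst ht
        exact ind₂_true rfl
      · rename_i ht
        refine ind₂_false fun he => ht ?_
        obtain ⟨e', i', hi'⟩ := t
        obtain ⟨rfl, rfl⟩ := P.eq_of_pt_eq (Nat.succ_pos i) h hi'.le (hθ _ _ _ _ hi'.le h.le he)
        rfl
    have h2 : ∀ t : P.Seg, ind₂ ((P.tgt t).1 + θ * (P.tgt t).2 =
        (P.pt e (i + 1)).1 + θ * (P.pt e (i + 1)).2) =
        if t = ⟨e, ⟨i, by omega⟩⟩ then 1 else 0 := by
      intro t
      split
      · rename_i ht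
        subst ht
        exact ind₂_true rfl
      · rename_i ht
        refine ind₂_false fun he => ht ?_
        obtain ⟨e', i', hi'⟩ := t
        obtain ⟨rfl, h3⟩ := P.eq_of_pt_eq (Nat.succ_pos i) h hi' (hθ _ _ _ _ hi' h.le he)
        obtain rfl : i' = i := by simpa using h3
        rfl
    simp only [h1, h2, mul_add, Finset.sum_add_distrib, mul_ite, mul_one, mul_zero,
      Finset.sum_ite_eq', Finset.mem_univ, if_true] at hs
    have two : ∀ a b : ZMod 2, a + b = 0 → a = b := by decide
    exact two _ _ hs
  refine ⟨fun e => Z ⟨e, ⟨0, (P.simple e).pos⟩⟩, ?_⟩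
  funext ⟨e, i, hi⟩
  induction i with
  | zero => rfl
  | succ i ih => rw [step e i hi, ih (by omega)]

end Polylines

/-- **Euler's inequality** for a graph that has a plane drawing and is not a forest. -/
theorem girth_mul_le [Fintype V] [Fintype G.edgeSet] (D : PlaneDrawing G) (hG : ¬ G.IsAcyclic) :
    G.girth * (Fintype.card G.edgeSet + 2) ≤
      2 * Fintype.card G.edgeSet + G.girth * Fintype.card V := by
  classical
  obtain ⟨P⟩ := D.nonempty_polylines
  obtain ⟨θ, A, hθ, hinj, hA⟩ := P.exists_arcSystem
  have mem : ∀ {Z}, Z ∈ A.cycles ↔ ∀ v, ∑ t, Z t *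
      (ind₂ ((P.src t).1 + θ * (P.src t).2 = v) + ind₂ ((P.tgt t).1 + θ * (P.tgt t).2 = v)) = 0 := by
    intro Z
    rw [A.mem_cycles]
    simp only [hA]
  let Φ : LinearMap.ker G.boundaryMod2 →ₗ[ZMod 2] A.cycles :=
    { toFun := fun c => ⟨fun t => c.1 t.1, mem.mpr fun v => by
        rw [P.sum_lift θ c.1 v, LinearMap.mem_ker.mp c.2]
        simp⟩
      map_add' := fun c c' => rfl
      map_smul' := fun a c => rfl }
  have hΦ : Function.Injective Φ := by
    intro c c' h
    ext e
    exact congrFun (congrArg Subtype.val h) ⟨e, ⟨0, (P.simple e).pos⟩⟩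
  have hrank := LinearMap.finrank_le_finrank_of_injective hΦ
  have hbot : A.cycles ≠ ⊥ := by
    obtain ⟨c, hc, hc0⟩ := Submodule.exists_mem_ne_zero_of_ne_bot
      (SimpleGraph.ker_boundaryMod2_ne_bot hG)
    intro h
    have h1 : Φ ⟨c, hc⟩ = 0 := by
      rw [← Subtype.coe_inj]
      exact (Submodule.mem_bot (ZMod 2)).mp (h ▸ (Φ ⟨c, hc⟩).2)
    have := hΦ (h1.trans (map_zero Φ).symm)
    exact hc0 (congrArg Subtype.val this)
  have hfirst : ∀ e : G.edgeSet, ∑ i : Fin (P.m e), (if i.1 = 0 then 1 else 0) = 1 := by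
    intro e
    rw [Finset.sum_eq_single ⟨0, (P.simple e).pos⟩]
    · simp
    · rintro ⟨i, hi⟩ - hne
      rw [if_neg]
      rintro rfl
      exact hne rfl
    · simp
  -- Weight 1 on the first segment of each edge and 0 on the others makes the weight of a cycle the
  -- number of its graph edges.
  have hbound := A.mul_finrank_add_one_le hbot (fun t => if t.2.1 = 0 then 1 else 0) G.girth (by
    intro Z hZ hZ0
    obtain ⟨c, rfl⟩ := P.exists_eq_comp_fst hθ (mem.mp hZ)
    have hc : G.boundaryMod2 c = 0 := by
      ext w
      have h := mem.mp hZ ((D.pos w).1 + θ * (D.pos w).2)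
      rw [P.sum_lift] at h
      rw [Finset.sum_eq_single w] at h
      · rwa [ind₂_true rfl, one_mul] at h
      · intro w' _ hne
        rw [ind₂_false fun h => hne (hinj _ _ h), zero_mul]
      · simp
    have hc0 : c ≠ 0 := by
      rintro rfl
      exact hZ0 rfl
    refine (SimpleGraph.girth_le_sum_of_boundaryMod2_eq_zero hc hc0).trans ?_
    rw [Fintype.sum_sigma]
    refine Finset.sum_le_sum fun e _ => ?_
    by_cases hce : c e = 0
    · simp [hce]
    · simp only [hce, if_false]
      rw [hfirst])
  rw [Fintype.sum_sigma, Finset.sum_congr rfl fun e _ => hfirst e] at hbound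
  simp only [Finset.sum_const, Finset.card_univ, smul_eq_mul, mul_one] at hbound
  obtain ⟨v, p, -⟩ : ∃ v, ∃ p : G.Walk v v, p.IsCycle := by
    rw [SimpleGraph.IsAcyclic] at hG
    push Not at hG
    exact hG
  have : Nonempty V := ⟨v⟩
  have hdim := G.card_edgeSet_add_one_le
  calc G.girth * (Fintype.card G.edgeSet + 2)
      ≤ G.girth * (Module.finrank (ZMod 2) A.cycles + 1 + Fintype.card V) :=
        Nat.mul_le_mul_left _ (by omega)
    _ = G.girth * (Module.finrank (ZMod 2) A.cycles + 1) + G.girth * Fintype.card V := by ring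
    _ ≤ _ := Nat.add_le_add_right hbound _

end PlaneDrawing

/-- A planar graph of girth `g` has at most `g / (g - 2) * (n - 2)` edges. -/
theorem IsPlanarGraph.card_edgeFinset_le {V : Type*} [Fintype V] {G : SimpleGraph V}
    [Fintype G.edgeSet] (hG : IsPlanarGraph G) {g : ℕ} (hg : 3 ≤ g) (h : G.girth = g) :
    (G.edgeFinset.card : ℝ) ≤ (g : ℝ) / ((g : ℝ) - 2) * ((Fintype.card V : ℝ) - 2) := by
  obtain ⟨D⟩ := hG
  have hcyc : ¬ G.IsAcyclic := fun h0 => by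
    have := SimpleGraph.girth_eq_zero.mpr h0
    omega
  have key := D.girth_mul_le hcyc
  rw [h, ← SimpleGraph.edgeFinset_card] at key
  have key' : (g : ℝ) * (G.edgeFinset.card + 2) ≤ 2 * G.edgeFinset.card + g * Fintype.card V := by
    exact_mod_cast key
  have hg' : (3 : ℝ) ≤ g := by exact_mod_cast hg
  rw [div_mul_eq_mul_div, le_div_iff₀ (by linarith)]
  linarith

/-! ### The polygonal spiral and its spokes. -/

/-- A sign that alternates from each half-turn of the spiral to the next. -/
noncomputable def spiralSign (I : ℕ) : ℝ := if Even I then -1 else 1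

lemma spiralSign_succ (I : ℕ) : spiralSign (I + 1) = -spiralSign I := by
  by_cases h : Even I <;> simp [spiralSign, Nat.even_add_one, h]

/-- The parity of I - J restricts the possible gaps between I and J; the gaps become linear
inequalities, which settle the geometric case checks below. -/
lemma spiralSign_cases (I J : ℕ) :
    (spiralSign I = spiralSign J ∧ (I = J ∨ I + 2 ≤ J ∨ J + 2 ≤ I)) ∨
      (spiralSign I = -spiralSign J ∧ (J = I + 1 ∨ I = J + 1 ∨ I + 3 ≤ J ∨ J + 3 ≤ I)) := by
  by_cases hI : Even I <;> by_cases hJ : Even J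
  · left; simp only [spiralSign, hI, hJ, if_true, true_and]; grind
  · right; simp only [spiralSign, hI, hJ, if_true, if_false, true_and]; grind
  · right; simp only [spiralSign, hI, hJ, if_true, if_false, neg_neg, true_and]; grind
  · left; simp only [spiralSign, hI, hJ, if_false, true_and]; grind

lemma spiralSign_mul_self (I : ℕ) : spiralSign I * spiralSign I = 1 := by
  by_cases h : Even I <;> simp [spiralSign, h]

lemma spiralSign_mul_left_inj {I : ℕ} {x y : ℝ} (h : spiralSign I * x = spiralSign I * y) :
    x = y := by
  have := congrArg (spiralSign I * ·) h
  simpa only [← mul_assoc, spiralSign_mul_self, one_mul] using this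

/-- A polygonal spiral around the origin. Its `I`-th half-turn consists of two diagonal segments,
parametrized by `[0, I]` and `[I, 2 * I]`, and of a unit segment on the axis, parametrized by
`[2 * I, 2 * I + 1]`. -/
noncomputable def spiral (I : ℕ) (t : ℝ) : ℝ × ℝ :=
  (spiralSign I * max (I - 1 - t) (t - 3 * I - 1), spiralSign I * max 0 (min t (2 * I - t)))

lemma spiral_of_le {I : ℕ} {t : ℝ} (h0 : 0 ≤ t) (h1 : t ≤ I) :
    spiral I t = (spiralSign I * (I - 1 - t), spiralSign I * t) := by
  rw [spiral, max_eq_left (by linarith), min_eq_left (by linarith), max_eq_right h0]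

lemma spiral_of_mid {I : ℕ} {t : ℝ} (h0 : I ≤ t) (h1 : t ≤ 2 * I) :
    spiral I t = (spiralSign I * (I - 1 - t), spiralSign I * (2 * I - t)) := by
  rw [spiral, max_eq_left (by linarith), min_eq_right (by linarith), max_eq_right (by linarith)]

lemma spiral_of_ge {I : ℕ} {t : ℝ} (h0 : 2 * I ≤ t) :
    spiral I t = (spiralSign I * (t - 3 * I - 1), 0) := by
  have hI : (0 : ℝ) ≤ I := Nat.cast_nonneg I
  rw [spiral, max_eq_right (by linarith), min_eq_right (by linarith), max_eq_left (by linarith),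
    mul_zero]

lemma spiral_coords {I : ℕ} {t : ℝ} (h0 : 0 ≤ t) : ∃ X Y : ℝ,
    spiral I t = (spiralSign I * X, spiralSign I * Y) ∧
      ((t ≤ I ∧ X = I - 1 - t ∧ Y = t) ∨ (I ≤ t ∧ t ≤ 2 * I ∧ X = I - 1 - t ∧ Y = 2 * I - t) ∨
        (2 * I ≤ t ∧ X = t - 3 * I - 1 ∧ Y = 0)) := by
  rcases le_total t I with h1 | h1
  · exact ⟨_, _, spiral_of_le h0 h1, Or.inl ⟨h1, rfl, rfl⟩⟩
  · rcases le_total t (2 * I) with h2 | h2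
    · exact ⟨_, _, spiral_of_mid h1 h2, Or.inr (Or.inl ⟨h1, h2, rfl, rfl⟩)⟩
    · exact ⟨_, 0, by rw [spiral_of_ge h2, mul_zero], Or.inr (Or.inr ⟨h2, rfl, rfl⟩)⟩

lemma spiral_last (I : ℕ) : spiral I (2 * I + 1) = spiral (I + 1) 0 := by
  have hI : (0 : ℝ) ≤ I := Nat.cast_nonneg I
  rw [spiral_of_ge (by linarith), spiral_of_le le_rfl (by positivity), spiralSign_succ]
  ext
  · push_cast
    ring
  · simp

/-- In the coordinates of `spiral_coords` the diagonals of half-turn I form the tent |X + 1| + Y =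
I, so half-turns of the same parity are nested. Those of opposite parity lie in opposite closed
half-planes and can meet only on the axis, where only consecutive ones touch. -/
lemma spiral_inj {I J : ℕ} {t t' : ℝ} (h0 : 0 ≤ t) (h1 : t ≤ 2 * I + 1) (h0' : 0 ≤ t')
    (h1' : t' ≤ 2 * J + 1) (h : spiral I t = spiral J t') :
    (I = J ∧ t = t') ∨ (J = I + 1 ∧ t = 2 * I + 1 ∧ t' = 0) ∨
      (I = J + 1 ∧ t' = 2 * J + 1 ∧ t = 0) := by
  obtain ⟨X, Y, e, hc⟩ := spiral_coords (I := I) h0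
  obtain ⟨X', Y', e', hc'⟩ := spiral_coords (I := J) h0'
  rw [e, e', Prod.mk.injEq] at h
  have hI : (0 : ℝ) ≤ I := Nat.cast_nonneg I
  have hJ : (0 : ℝ) ≤ J := Nat.cast_nonneg J
  rcases spiralSign_cases I J with ⟨hs, hIJ⟩ | ⟨hs, hIJ⟩
  · rw [hs] at h
    have hX := spiralSign_mul_left_inj h.1
    have hY := spiralSign_mul_left_inj h.2
    left
    rcases hIJ with rfl | hIJ | hIJ
    · refine ⟨rfl, ?_⟩
      rcases Nat.eq_zero_or_pos I with rfl | hI1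
      · simp only [Nat.cast_zero] at *
        rcases hc with ⟨_, _, _⟩ | ⟨_, _, _, _⟩ | ⟨_, _, _⟩ <;>
          rcases hc' with ⟨_, _, _⟩ | ⟨_, _, _, _⟩ | ⟨_, _, _⟩ <;> linarith
      · have hI2 : (1 : ℝ) ≤ I := by exact_mod_cast hI1
        rcases hc with ⟨_, _, _⟩ | ⟨_, _, _, _⟩ | ⟨_, _, _⟩ <;>
          rcases hc' with ⟨_, _, _⟩ | ⟨_, _, _, _⟩ | ⟨_, _, _⟩ <;> linarith
    · have hIJ' : (I : ℝ) + 2 ≤ J := by exact_mod_cast hIJ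
      exfalso
      rcases hc with ⟨_, _, _⟩ | ⟨_, _, _, _⟩ | ⟨_, _, _⟩ <;>
          rcases hc' with ⟨_, _, _⟩ | ⟨_, _, _, _⟩ | ⟨_, _, _⟩ <;> linarith
    · have hIJ' : (J : ℝ) + 2 ≤ I := by exact_mod_cast hIJ
      exfalso
      rcases hc with ⟨_, _, _⟩ | ⟨_, _, _, _⟩ | ⟨_, _, _⟩ <;>
          rcases hc' with ⟨_, _, _⟩ | ⟨_, _, _, _⟩ | ⟨_, _, _⟩ <;> linarith
  · rw [hs, neg_mul, neg_mul, ← mul_neg, ← mul_neg] at h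
    have hX := spiralSign_mul_left_inj h.1
    have hY := spiralSign_mul_left_inj h.2
    right
    rcases hIJ with hIJ | hIJ | hIJ | hIJ
    · have hIJ' : (J : ℝ) = I + 1 := by exact_mod_cast hIJ
      refine Or.inl ⟨hIJ, ?_⟩
      have h01 : (I : ℝ) = 0 ∨ (1 : ℝ) ≤ I := by
        rcases Nat.eq_zero_or_pos I with h | h
        · exact Or.inl (by exact_mod_cast h)
        · exact Or.inr (by exact_mod_cast h)
      rcases h01 with h01 | h01 <;> rcases hc with ⟨_, _, _⟩ | ⟨_, _, _, _⟩ | ⟨_, _, _⟩ <;>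
          rcases hc' with ⟨_, _, _⟩ | ⟨_, _, _, _⟩ | ⟨_, _, _⟩ <;> constructor <;> linarith
    · have hIJ' : (I : ℝ) = J + 1 := by exact_mod_cast hIJ
      refine Or.inr ⟨hIJ, ?_⟩
      have h01 : (J : ℝ) = 0 ∨ (1 : ℝ) ≤ J := by
        rcases Nat.eq_zero_or_pos J with h | h
        · exact Or.inl (by exact_mod_cast h)
        · exact Or.inr (by exact_mod_cast h)
      rcases h01 with h01 | h01 <;> rcases hc with ⟨_, _, _⟩ | ⟨_, _, _, _⟩ | ⟨_, _, _⟩ <;>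
          rcases hc' with ⟨_, _, _⟩ | ⟨_, _, _, _⟩ | ⟨_, _, _⟩ <;> constructor <;> linarith
    · have hIJ' : (I : ℝ) + 3 ≤ J := by exact_mod_cast hIJ
      exfalso
      rcases hc with ⟨_, _, _⟩ | ⟨_, _, _, _⟩ | ⟨_, _, _⟩ <;>
          rcases hc' with ⟨_, _, _⟩ | ⟨_, _, _, _⟩ | ⟨_, _, _⟩ <;> linarith
    · have hIJ' : (J : ℝ) + 3 ≤ I := by exact_mod_cast hIJ
      exfalso
      rcases hc with ⟨_, _, _⟩ | ⟨_, _, _, _⟩ | ⟨_, _, _⟩ <;>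
          rcases hc' with ⟨_, _, _⟩ | ⟨_, _, _, _⟩ | ⟨_, _, _⟩ <;> linarith

/-- The unit segment on the axis that leads from the spiral to its next winding. -/
noncomputable def spoke (i : ℕ) : Set (ℝ × ℝ) := segment ℝ (spiral i (2 * i)) (spiral (i + 3) 0)

lemma mem_spoke {i : ℕ} {z : ℝ × ℝ} (hz : z ∈ spoke i) :
    ∃ r : ℝ, (i : ℝ) + 1 ≤ r ∧ r ≤ i + 2 ∧ z = (spiralSign i * -r, 0) := by
  have hi : (0 : ℝ) ≤ i := Nat.cast_nonneg i
  rw [spoke, spiral_of_ge le_rfl, spiral_of_le le_rfl (by positivity), segment_eq_image] at hz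
  obtain ⟨s, ⟨hs0, hs1⟩, rfl⟩ := hz
  refine ⟨i + 1 + s, by linarith, by linarith, ?_⟩
  rw [show i + 3 = i + 1 + 1 + 1 by ring, spiralSign_succ, spiralSign_succ, spiralSign_succ]
  ext
  · simp only [Prod.fst_add, Prod.smul_fst, smul_eq_mul]
    push_cast
    ring
  · simp

/-- On its half of the axis, the spoke covers the distances [i + 1, i + 2] from the origin. This is
the gap between the unit segments of half-turns i and i + 2, which cover [i, i + 1] and [i + 2, i +
3]. -/
lemma spoke_inter_spiral {i J : ℕ} {t : ℝ} (h0 : 0 ≤ t) (h1 : t ≤ 2 * J + 1)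
    (h : spiral J t ∈ spoke i) :
    spiral J t = spiral i (2 * i) ∨ spiral J t = spiral (i + 3) 0 := by
  obtain ⟨r, hr1, hr2, hr⟩ := mem_spoke h
  have hi : (0 : ℝ) ≤ i := Nat.cast_nonneg i
  have hJ : (0 : ℝ) ≤ J := Nat.cast_nonneg J
  have key : r = i + 1 ∨ r = i + 2 := by
    obtain ⟨X, Y, e, hc⟩ := spiral_coords (I := J) h0
    rw [e, Prod.mk.injEq] at hr
    have hY : Y = 0 := spiralSign_mul_left_inj (I := J) (by rw [hr.2, mul_zero])
    rcases spiralSign_cases J i with ⟨hs, hIJ⟩ | ⟨hs, hIJ⟩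
    · rw [hs] at hr
      have hX := spiralSign_mul_left_inj hr.1
      rcases hIJ with hIJ | hIJ | hIJ
      · have hIJ' : (J : ℝ) = i := by exact_mod_cast hIJ
        left
        rcases hc with ⟨_, _, _⟩ | ⟨_, _, _, _⟩ | ⟨_, _, _⟩ <;> linarith
      · have hIJ' : (J : ℝ) + 2 ≤ i := by exact_mod_cast hIJ
        left
        rcases hc with ⟨_, _, _⟩ | ⟨_, _, _, _⟩ | ⟨_, _, _⟩ <;> linarith
      · have hIJ' : (i : ℝ) + 2 ≤ J := by exact_mod_cast hIJ
        right
        rcases hc with ⟨_, _, _⟩ | ⟨_, _, _, _⟩ | ⟨_, _, _⟩ <;> linarith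
    · rw [hs, neg_mul, ← mul_neg] at hr
      have hX := spiralSign_mul_left_inj hr.1
      rcases hIJ with hIJ | hIJ | hIJ | hIJ
      · have hIJ' : (i : ℝ) = J + 1 := by exact_mod_cast hIJ
        left
        rcases hc with ⟨_, _, _⟩ | ⟨_, _, _, _⟩ | ⟨_, _, _⟩ <;> linarith
      · have hIJ' : (J : ℝ) = i + 1 := by exact_mod_cast hIJ
        left
        rcases hc with ⟨_, _, _⟩ | ⟨_, _, _, _⟩ | ⟨_, _, _⟩ <;> linarith
      · have hIJ' : (J : ℝ) + 3 ≤ i := by exact_mod_cast hIJ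
        left
        rcases hc with ⟨_, _, _⟩ | ⟨_, _, _, _⟩ | ⟨_, _, _⟩ <;> linarith
      · have hIJ' : (i : ℝ) + 3 ≤ J := by exact_mod_cast hIJ
        right
        rcases hc with ⟨_, _, _⟩ | ⟨_, _, _, _⟩ | ⟨_, _, _⟩ <;> linarith
  rcases key with rfl | rfl
  · left
    rw [hr, spiral_of_ge le_rfl]
    ext
    · simp only
      ring
    · rfl
  · right
    rw [hr, spiral_of_le le_rfl (by positivity), show i + 3 = i + 1 + 1 + 1 by ring,
      spiralSign_succ, spiralSign_succ, spiralSign_succ]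
    ext
    · push_cast
      ring
    · simp

lemma disjoint_spoke {i j : ℕ} (hij : i ≠ j) : Disjoint (spoke i) (spoke j) := by
  rw [Set.disjoint_left]
  intro z hz hz'
  obtain ⟨r, hr1, hr2, rfl⟩ := mem_spoke hz
  obtain ⟨r', hr1', hr2', h⟩ := mem_spoke hz'
  have hi : (0 : ℝ) ≤ i := Nat.cast_nonneg i
  have hj : (0 : ℝ) ≤ j := Nat.cast_nonneg j
  rw [Prod.mk.injEq] at h
  rcases spiralSign_cases i j with ⟨hs, hIJ⟩ | ⟨hs, hIJ⟩
  · rw [hs] at h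
    have hX := spiralSign_mul_left_inj h.1
    rcases hIJ with hIJ | hIJ | hIJ
    · exact hij hIJ
    · have hIJ' : (i : ℝ) + 2 ≤ j := by exact_mod_cast hIJ
      linarith
    · have hIJ' : (j : ℝ) + 2 ≤ i := by exact_mod_cast hIJ
      linarith
  · rw [hs, neg_mul, ← mul_neg] at h
    have hX := spiralSign_mul_left_inj h.1
    linarith

/-! ### Pieces of the spiral as polygonal arcs, and a planarity criterion. -/

lemma isPolygonalArc_segment {p q : ℝ × ℝ} (h : p ≠ q) : IsPolygonalArc p q (segment ℝ p q) := by
  refine ⟨1, fun i => if i = 0 then p else q, one_pos, rfl, rfl, ?_, ?_, ?_, ?_⟩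
  · intro i hi
    obtain rfl : i = 0 := by omega
    simpa using h
  · intro i hi
    omega
  · intro i j _ _
    omega
  · have : Set.Iio 1 = ({0} : Set ℕ) := by ext; simp
    simp [this]

lemma isPolygonalArc_union {p q r : ℝ × ℝ} (hpq : p ≠ q) (hqr : q ≠ r)
    (h : segment ℝ p q ∩ segment ℝ q r = {q}) :
    IsPolygonalArc p r (segment ℝ p q ∪ segment ℝ q r) := by
  refine ⟨2, fun i => if i = 0 then p else if i = 1 then q else r, two_pos, rfl, rfl, ?_, ?_, ?_,
    ?_⟩
  · intro i hi
    obtain rfl | rfl : i = 0 ∨ i = 1 := by omega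
    · simpa using hpq
    · simpa using hqr
  · intro i hi
    obtain rfl : i = 0 := by omega
    simpa using h
  · intro i j _ _
    omega
  · have : Set.Iio 2 = ({0, 1} : Set ℕ) := by ext; simp; omega
    simp [this]

lemma image_Icc_eq_segment {f : ℝ → ℝ × ℝ} {a b : ℝ} (hab : a ≤ b) (p v : ℝ × ℝ)
    (h : ∀ t ∈ Set.Icc a b, f t = p + t • v) : f '' Set.Icc a b = segment ℝ (f a) (f b) := by
  have h1 : f '' Set.Icc a b = (AffineMap.lineMap p (p + v) : ℝ →ᵃ[ℝ] ℝ × ℝ) '' segment ℝ a b := by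
    rw [segment_eq_Icc hab]
    refine Set.image_congr fun t ht => ?_
    rw [h t ht, AffineMap.lineMap_apply]
    simp [add_comm]
  have h2 : ∀ t, (AffineMap.lineMap p (p + v) : ℝ →ᵃ[ℝ] ℝ × ℝ) t = p + t • v := fun t => by
    rw [AffineMap.lineMap_apply]
    simp [add_comm]
  rw [h1, image_segment, h2, h2, h a ⟨le_rfl, hab⟩, h b ⟨hab, le_rfl⟩]

lemma spiral_image_left (I : ℕ) :
    spiral I '' Set.Icc 0 I = segment ℝ (spiral I 0) (spiral I I) := by
  refine image_Icc_eq_segment (Nat.cast_nonneg I) (spiralSign I * (I - 1), 0)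
    (-spiralSign I, spiralSign I) fun t ht => ?_
  rw [spiral_of_le ht.1 ht.2]
  ext
  · simp
    ring
  · simp
    ring

lemma spiral_image_mid {I : ℕ} {a b : ℝ} (ha : I ≤ a) (hab : a ≤ b) (hb : b ≤ 2 * I) :
    spiral I '' Set.Icc a b = segment ℝ (spiral I a) (spiral I b) := by
  refine image_Icc_eq_segment hab (spiralSign I * (I - 1), spiralSign I * (2 * I))
    (-spiralSign I, -spiralSign I) fun t ht => ?_
  rw [spiral_of_mid (ha.trans ht.1) (ht.2.trans hb)]
  ext <;> simp <;> ring

lemma spiral_image_right {I : ℕ} {a b : ℝ} (ha : 2 * I ≤ a) (hab : a ≤ b) :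
    spiral I '' Set.Icc a b = segment ℝ (spiral I a) (spiral I b) := by
  refine image_Icc_eq_segment hab (spiralSign I * (-3 * I - 1), 0) (spiralSign I, 0) fun t ht => ?_
  rw [spiral_of_ge (ha.trans ht.1)]
  ext
  · simp
    ring
  · simp

/-- A part of a half-turn of the spiral in which no vertex but the peak is interior. -/
lemma isPolygonalArc_spiral {I : ℕ} {a b : ℝ} (h0 : 0 ≤ a) (hab : a < b) (hb : b ≤ 2 * I + 1)
    (h : (a = 0 ∧ I < b ∧ b ≤ 2 * I) ∨ (I ≤ a ∧ b ≤ 2 * I) ∨ 2 * I ≤ a) :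
    IsPolygonalArc (spiral I a) (spiral I b) (spiral I '' Set.Icc a b) ∧
      IsPolygonalArc (spiral I b) (spiral I a) (spiral I '' Set.Icc a b) := by
  have hI : (0 : ℝ) ≤ I := Nat.cast_nonneg I
  have hinj : ∀ t t' : ℝ, 0 ≤ t → t ≤ 2 * I + 1 → 0 ≤ t' → t' ≤ 2 * I + 1 →
      spiral I t = spiral I t' → t = t' := by
    intro t t' h1 h2 h3 h4 he
    rcases spiral_inj h1 h2 h3 h4 he with h | h | h
    · exact h.2
    · omega
    · omega
  have hne : spiral I a ≠ spiral I b := fun he =>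
    hab.ne (hinj _ _ h0 (by linarith) (by linarith) hb he)
  have single : spiral I '' Set.Icc a b = segment ℝ (spiral I a) (spiral I b) →
      IsPolygonalArc (spiral I a) (spiral I b) (spiral I '' Set.Icc a b) ∧
      IsPolygonalArc (spiral I b) (spiral I a) (spiral I '' Set.Icc a b) := fun he => by
    rw [he]
    refine ⟨isPolygonalArc_segment hne, ?_⟩
    rw [segment_symm]
    exact isPolygonalArc_segment hne.symm
  rcases h with ⟨rfl, h1, h2⟩ | ⟨h1, h2⟩ | h1
  · have hI0 : (0 : ℝ) < I := by
      rcases Nat.eq_zero_or_pos I with rfl | h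
      · norm_num at h2
        linarith
      · exact_mod_cast h
    have e1 := spiral_image_left I
    have e2 := spiral_image_mid (I := I) le_rfl h1.le h2
    have hne1 : spiral I 0 ≠ spiral I I := fun he =>
      hI0.ne (hinj _ _ le_rfl (by linarith) hI (by linarith) he)
    have hne2 : spiral I I ≠ spiral I b := fun he =>
      h1.ne (hinj _ _ hI (by linarith) (by linarith) hb he)
    have hint : segment ℝ (spiral I 0) (spiral I I) ∩ segment ℝ (spiral I I) (spiral I b) =
        {spiral I I} := by
      rw [← e1, ← e2]
      ext z
      constructor
      · rintro ⟨⟨t, ht, rfl⟩, ⟨t', ht', he⟩⟩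
        have := hinj _ _ (by linarith [ht'.1]) (by linarith [ht'.2]) ht.1 (by linarith [ht.2]) he
        have : t = I := by linarith [ht.2, ht'.1]
        rw [this]
        rfl
      · rintro rfl
        exact ⟨⟨I, ⟨hI, le_rfl⟩, rfl⟩, ⟨I, ⟨le_rfl, h1.le⟩, rfl⟩⟩
    rw [← Set.Icc_union_Icc_eq_Icc hI h1.le, Set.image_union, e1, e2]
    refine ⟨isPolygonalArc_union hne1 hne2 hint, ?_⟩
    rw [Set.union_comm, segment_symm ℝ (spiral I I), segment_symm ℝ (spiral I 0)]
    refine isPolygonalArc_union hne2.symm hne1.symm ?_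
    rw [Set.inter_comm, segment_symm ℝ (spiral I b), segment_symm ℝ (spiral I I)]
    exact hint
  · exact single (spiral_image_mid h1 hab.le h2)
  · exact single (spiral_image_right h1 hab.le)

lemma isPolygonalArc_spoke (i : ℕ) :
    IsPolygonalArc (spiral i (2 * i)) (spiral (i + 3) 0) (spoke i) ∧
      IsPolygonalArc (spiral (i + 3) 0) (spiral i (2 * i)) (spoke i) := by
  have hi : (0 : ℝ) ≤ i := Nat.cast_nonneg i
  have hne : spiral i (2 * i) ≠ spiral (i + 3) 0 := fun h => by
    rcases spiral_inj (by linarith) (by linarith) le_rfl (by positivity) h with h | h | h <;> omega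
  refine ⟨isPolygonalArc_segment hne, ?_⟩
  rw [spoke, segment_symm]
  exact isPolygonalArc_segment hne.symm

/-- A criterion for planarity, for a graph whose edges are indexed without repetition. -/
lemma isPlanarGraph_of_arcs {V ι : Type*} {G : SimpleGraph V} (a b : ι → V) (pos : V → ℝ × ℝ)
    (arc : ι → Set (ℝ × ℝ)) (hpos : Function.Injective pos)
    (hG : ∀ u v, G.Adj u v ↔ ∃ i, s(a i, b i) = s(u, v))
    (hinj : Function.Injective fun i => s(a i, b i))
    (harc : ∀ i, IsPolygonalArc (pos (a i)) (pos (b i)) (arc i) ∧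
      IsPolygonalArc (pos (b i)) (pos (a i)) (arc i))
    (hmem : ∀ i w, pos w ∈ arc i → w = a i ∨ w = b i)
    (hinter : ∀ i j, i ≠ j → arc i ∩ arc j ⊆ Set.range pos) : IsPlanarGraph G := by
  have hcurve : ∀ i, (⋃ j ∈ {j | s(a j, b j) = s(a i, b i)}, arc j) = arc i := by
    intro i
    have : {j | s(a j, b j) = s(a i, b i)} = {i} := by
      ext j
      exact ⟨fun h => hinj h, fun h => by rw [Set.mem_singleton_iff.mp h]; rfl⟩
    rw [this, Set.biUnion_singleton]
  have hedge : ∀ e ∈ G.edgeSet, ∃ i, e = s(a i, b i) := by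
    intro e he
    induction e with
    | h u v =>
      obtain ⟨i, hi⟩ := (hG u v).mp he
      exact ⟨i, hi.symm⟩
  -- The union avoids choosing an index for `e`; by `hinj` it consists of one arc when `e` is an
  -- edge.
  refine ⟨⟨pos, fun e => ⋃ j ∈ {j | s(a j, b j) = e}, arc j, hpos, ?_, ?_, ?_⟩⟩
  · intro u v huv
    obtain ⟨i, hi⟩ := (hG u v).mp huv
    rw [← hi, hcurve]
    rcases Sym2.eq_iff.mp hi with ⟨rfl, rfl⟩ | ⟨rfl, rfl⟩
    · exact (harc i).1
    · exact (harc i).2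
  · intro e he w hw
    obtain ⟨i, rfl⟩ := hedge e he
    rw [hcurve] at hw
    exact Sym2.mem_iff.mpr (hmem i w hw)
  · intro e he f hf hef z hz
    obtain ⟨i, rfl⟩ := hedge e he
    obtain ⟨j, rfl⟩ := hedge f hf
    rw [hcurve, hcurve] at hz
    obtain ⟨w, rfl⟩ := hinter i j (fun h => hef (by rw [h])) hz
    exact ⟨w, ⟨Sym2.mem_iff.mpr (hmem i w hz.1), Sym2.mem_iff.mpr (hmem j w hz.2)⟩, rfl⟩

/-! ### The extremal graph and its drawing along the spiral. -/

namespace SpiralGraph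

/-- The inner end of the `i`-th chord. -/
def lo (q i : ℕ) : ℕ := q * i / 2

/-- The outer end of the `i`-th chord. -/
def hi (q i : ℕ) : ℕ := q + 1 + (q * i + 1) / 2

/-- The first vertex of a half-turn of the spiral. -/
def start (q : ℕ) : ℕ → ℕ
  | 0 => 0
  | I + 1 => 1 + (q * I + 1) / 2

/-- The half-turn that contains a vertex. -/
def stage (q τ : ℕ) : ℕ := if τ = 0 then 0 else 2 * (τ - 1) / q + 1

/-- The parameter of a vertex in a half-turn of the spiral. -/
noncomputable def time (q I τ : ℕ) : ℝ :=
  if τ = start q I then 0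
  else if τ ≤ lo q I then 2 * I - I * (((lo q I : ℝ) - τ) / ((lo q I : ℝ) - start q I))
  else 2 * I + ((τ : ℝ) - lo q I) / ((start q (I + 1) : ℝ) - lo q I)

/-- Chord i can thus be drawn as `spoke i`: it leads from the end of the diagonals of half-turn i to
the start of half-turn i + 3. -/
lemma hi_eq_start (q i : ℕ) : hi q i = start q (i + 3) := by
  simp only [hi, start, Nat.mul_add]
  omega

lemma lo_lt_start (q I : ℕ) : lo q I < start q (I + 1) := by
  simp only [lo, start]
  omega

lemma time_start (q I : ℕ) : time q I (start q I) = 0 := if_pos rfl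

/-- The interpolation formula would give `start q I` the parameter I of the peak. Later vertices
therefore lie strictly beyond the peak, and only the edge that leaves `start q I` bends there. -/
lemma time_of_le_lo {q I τ : ℕ} (h1 : start q I < τ) (h2 : τ ≤ lo q I) :
    (I : ℝ) < time q I τ ∧ time q I τ ≤ 2 * I := by
  have hI : 0 < I := by
    rcases Nat.eq_zero_or_pos I with rfl | h
    · simp [lo] at h2
      omega
    · exact h
  have hI' : (0 : ℝ) < I := by exact_mod_cast hI
  have h1' : (start q I : ℝ) < τ := by exact_mod_cast h1
  have h2' : (τ : ℝ) ≤ lo q I := by exact_mod_cast h2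
  rw [time, if_neg (by omega), if_pos h2]
  have h3 : ((lo q I : ℝ) - τ) / ((lo q I : ℝ) - start q I) < 1 := by
    rw [div_lt_one (by linarith)]
    linarith
  have h4 : 0 ≤ ((lo q I : ℝ) - τ) / ((lo q I : ℝ) - start q I) :=
    div_nonneg (by linarith) (by linarith)
  constructor
  · nlinarith
  · nlinarith

/-- The point that represents a vertex. -/
noncomputable def pos (q τ : ℕ) : ℝ × ℝ := spiral (stage q τ) (time q (stage q τ) τ)

/-- The part of the spiral between two consecutive vertices. -/
noncomputable def arc (q τ : ℕ) : Set (ℝ × ℝ) :=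
  spiral (stage q τ) '' Set.Icc (time q (stage q τ) τ) (time q (stage q τ) (τ + 1))

section

variable {q : ℕ} (hq : 4 ≤ q)
include hq

/-- Here `4 ≤ q`, that is g ≥ 6, matters: for q = 3 the vertices `start q 1` and `lo q 1` coincide.
-/
lemma start_lt_lo {I : ℕ} (hI : 0 < I) : start q I < lo q I := by
  obtain ⟨J, rfl⟩ : ∃ J, I = J + 1 := ⟨I - 1, by omega⟩
  simp only [lo, start, Nat.mul_add]
  rcases eq_or_lt_of_le hq with rfl | hq
  · omega
  · omega

lemma start_le_lo (I : ℕ) : start q I ≤ lo q I := by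
  rcases Nat.eq_zero_or_pos I with rfl | h
  · simp [start, lo]
  · exact (start_lt_lo hq h).le

lemma start_strictMono : StrictMono (start q) :=
  strictMono_nat_of_lt_succ fun I => (start_le_lo hq I).trans_lt (lo_lt_start q I)

lemma stage_spec (τ : ℕ) : start q (stage q τ) ≤ τ ∧ τ < start q (stage q τ + 1) := by
  unfold stage
  split
  · rename_i h
    subst h
    simp [start]
  · have h1 := Nat.div_mul_le_self (2 * (τ - 1)) q
    have h2 := Nat.lt_div_mul_add (a := 2 * (τ - 1)) (b := q) (by omega)
    generalize 2 * (τ - 1) / q = J at h1 h2 ⊢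
    rw [mul_comm J q] at h1 h2
    simp only [start, Nat.mul_add]
    omega

lemma stage_eq {I τ : ℕ} (h1 : start q I ≤ τ) (h2 : τ < start q (I + 1)) : stage q τ = I := by
  obtain ⟨h3, h4⟩ := stage_spec hq τ
  have hm := start_strictMono hq
  have := hm.lt_iff_lt.mp (h1.trans_lt h4)
  have := hm.lt_iff_lt.mp (h3.trans_lt h2)
  omega

lemma time_last (I : ℕ) : time q I (start q (I + 1)) = 2 * I + 1 := by
  have h1 := lo_lt_start q I
  have h2 := start_le_lo hq I
  have h3 : (lo q I : ℝ) < start q (I + 1) := by exact_mod_cast h1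
  rw [time, if_neg (by omega), if_neg (by omega), div_self (by linarith)]

lemma time_lo (I : ℕ) : time q I (lo q I) = 2 * I := by
  rcases Nat.eq_zero_or_pos I with rfl | h
  · simp [time, lo, start]
  · have := start_lt_lo hq h
    rw [time, if_neg (by omega), if_pos le_rfl, sub_self, zero_div, mul_zero, sub_zero]

lemma time_of_lo_lt {I τ : ℕ} (h1 : lo q I < τ) : 2 * (I : ℝ) < time q I τ := by
  have h2 := start_le_lo hq I
  have h3 : (lo q I : ℝ) < start q (I + 1) := by exact_mod_cast lo_lt_start q I
  have h4 : (lo q I : ℝ) < τ := by exact_mod_cast h1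
  rw [time, if_neg (by omega), if_neg (by omega)]
  have := div_pos (sub_pos.mpr h4) (sub_pos.mpr h3)
  linarith

lemma time_lt {I τ τ' : ℕ} (h1 : start q I ≤ τ) (h2 : τ < τ') : time q I τ < time q I τ' := by
  have hI : (0 : ℝ) ≤ I := Nat.cast_nonneg I
  rcases eq_or_lt_of_le h1 with h1 | h1
  · rw [← h1, time_start]
    rcases le_or_gt τ' (lo q I) with h3 | h3
    · linarith [(time_of_le_lo (by omega) h3).1]
    · linarith [time_of_lo_lt hq h3]
  · rcases le_or_gt τ (lo q I) with h4 | h4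
    · rcases le_or_gt τ' (lo q I) with h3 | h3
      · have hI : (0 : ℝ) < I := by linarith [(time_of_le_lo h1 h4)]
        have h5 : (start q I : ℝ) < lo q I := by exact_mod_cast h1.trans_le h4
        have h6 : (τ : ℝ) < τ' := by exact_mod_cast h2
        simp only [time]
        rw [if_neg (show τ ≠ start q I by omega), if_neg (show τ' ≠ start q I by omega), if_pos h4,
          if_pos h3]
        have : ((lo q I : ℝ) - τ') / ((lo q I : ℝ) - start q I) <
            ((lo q I : ℝ) - τ) / ((lo q I : ℝ) - start q I) :=
          div_lt_div_of_pos_right (by linarith) (by linarith)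
        nlinarith
      · exact (time_of_le_lo h1 h4).2.trans_lt (time_of_lo_lt hq h3)
    · have h3 : (lo q I : ℝ) < start q (I + 1) := by exact_mod_cast lo_lt_start q I
      have h6 : (τ : ℝ) < τ' := by exact_mod_cast h2
      simp only [time]
      rw [if_neg (show τ ≠ start q I by omega), if_neg (show τ' ≠ start q I by omega),
        if_neg (show ¬ τ ≤ lo q I by omega), if_neg (show ¬ τ' ≤ lo q I by omega)]
      have : ((τ : ℝ) - lo q I) / ((start q (I + 1) : ℝ) - lo q I) <
          ((τ' : ℝ) - lo q I) / ((start q (I + 1) : ℝ) - lo q I) :=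
        div_lt_div_of_pos_right (by linarith) (by linarith)
      linarith

lemma time_le {I τ τ' : ℕ} (h1 : start q I ≤ τ) (h2 : τ ≤ τ') : time q I τ ≤ time q I τ' := by
  rcases eq_or_lt_of_le h2 with rfl | h2
  · exact le_rfl
  · exact (time_lt hq h1 h2).le

lemma time_nonneg {I τ : ℕ} (h1 : start q I ≤ τ) : 0 ≤ time q I τ := by
  rw [← time_start q I]
  exact time_le hq le_rfl h1

lemma time_le_last {I τ : ℕ} (h1 : start q I ≤ τ) (h2 : τ ≤ start q (I + 1)) :
    time q I τ ≤ 2 * I + 1 := by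
  rw [← time_last hq I]
  exact time_le hq h1 h2

lemma pos_eq {I τ : ℕ} (h1 : start q I ≤ τ) (h2 : τ ≤ start q (I + 1)) :
    pos q τ = spiral I (time q I τ) := by
  rcases eq_or_lt_of_le h2 with rfl | h2
  · rw [pos, stage_eq hq le_rfl (start_strictMono hq (Nat.lt_succ_self _)), time_start,
      time_last hq, spiral_last]
  · rw [pos, stage_eq hq h1 h2]

lemma pos_lo (i : ℕ) : pos q (lo q i) = spiral i (2 * i) := by
  rw [pos_eq hq (start_le_lo hq i) (lo_lt_start q i).le, time_lo hq]

lemma pos_hi (i : ℕ) : pos q (hi q i) = spiral (i + 3) 0 := by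
  rw [hi_eq_start, pos_eq hq le_rfl (start_strictMono hq (Nat.lt_succ_self _)).le, time_start]

lemma pos_succ (τ : ℕ) : pos q (τ + 1) = spiral (stage q τ) (time q (stage q τ) (τ + 1)) := by
  obtain ⟨h1, h2⟩ := stage_spec hq τ
  exact pos_eq hq (by omega) h2

lemma isPolygonalArc_arc (τ : ℕ) :
    IsPolygonalArc (pos q τ) (pos q (τ + 1)) (arc q τ) ∧
      IsPolygonalArc (pos q (τ + 1)) (pos q τ) (arc q τ) := by
  obtain ⟨h1, h2⟩ := stage_spec hq τ
  rw [pos_succ hq, pos, arc]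
  set I := stage q τ
  refine isPolygonalArc_spiral (time_nonneg hq h1) (time_lt hq h1 (Nat.lt_succ_self _))
    (time_le_last hq (by omega) h2) ?_
  rcases le_or_gt (lo q I) τ with h | h
  · right; right
    rw [← time_lo hq I]
    exact time_le hq (start_le_lo hq I) h
  · have h3 := time_of_le_lo (show start q I < τ + 1 by omega) h
    rcases eq_or_lt_of_le h1 with h1 | h1
    · left
      exact ⟨by rw [← h1, time_start], h3⟩
    · right; left
      exact ⟨(time_of_le_lo h1 h.le).1.le, h3.2⟩

/-- By `spiral_inj` and the monotonicity of `time`, arcs share a point only at a common vertex,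
either inside one half-turn or at the junction of two consecutive ones. -/
lemma eq_of_mem_arc {τ τ' : ℕ} (hlt : τ < τ') {z : ℝ × ℝ} (hz : z ∈ arc q τ) (hz' : z ∈ arc q τ') :
    τ' = τ + 1 ∧ z = pos q τ' := by
  obtain ⟨h1, h2⟩ := stage_spec hq τ
  obtain ⟨h1', h2'⟩ := stage_spec hq τ'
  have hm := start_strictMono hq
  obtain ⟨t, ⟨ht1, ht2⟩, rfl⟩ := hz
  obtain ⟨t', ⟨ht1', ht2'⟩, he⟩ := hz'
  rw [pos, ← he]
  set I := stage q τ
  set J := stage q τ'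
  have b1 := time_nonneg hq h1
  have b2 := time_le_last hq (show start q I ≤ τ + 1 by omega) h2
  have b1' := time_nonneg hq h1'
  have b2' := time_le_last hq (show start q J ≤ τ' + 1 by omega) h2'
  rcases spiral_inj (by linarith) (by linarith) (by linarith) (by linarith) he.symm with
    ⟨hIJ, htt⟩ | ⟨hIJ, e1, e2⟩ | ⟨hIJ, -, -⟩
  · rw [← hIJ] at ht1' ⊢
    have h3 := time_le hq (show start q I ≤ τ + 1 by omega) (show τ + 1 ≤ τ' from hlt)
    have h4 : ¬ τ + 1 < τ' := fun h4 => by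
      have := time_lt hq (show start q I ≤ τ + 1 by omega) h4
      linarith
    have h5 : τ' = τ + 1 := by omega
    refine ⟨h5, ?_⟩
    congr 1
    rw [h5] at ht1' ⊢
    linarith
  · have h3 : ¬ τ + 1 < start q (I + 1) := fun h3 => by
      have := time_lt hq (show start q I ≤ τ + 1 by omega) h3
      rw [time_last hq] at this
      linarith
    have h4 : ¬ start q J < τ' := fun h4 => by
      have := time_lt hq le_rfl h4
      rw [time_start] at this
      linarith
    rw [← hIJ] at h3
    refine ⟨by omega, ?_⟩
    rw [e2, show τ' = start q J by omega, time_start]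
  · have := hm.monotone (show J + 1 ≤ I by omega)
    omega

lemma pos_mem_arc (τ : ℕ) : pos q τ ∈ arc q τ :=
  ⟨_, ⟨le_rfl, (time_lt hq (stage_spec hq τ).1 (Nat.lt_succ_self _)).le⟩, rfl⟩

lemma pos_injective : Function.Injective (pos q) := by
  intro τ τ' he
  by_contra hne
  wlog hlt : τ < τ' generalizing τ τ'
  · exact this he.symm (Ne.symm hne) (by omega)
  obtain ⟨h1, h2⟩ := stage_spec hq τ
  obtain ⟨h1', h2'⟩ := stage_spec hq τ'
  have hm := start_strictMono hq
  rw [pos, pos] at he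
  set I := stage q τ
  set J := stage q τ'
  rcases spiral_inj (time_nonneg hq h1) (time_le_last hq h1 h2.le) (time_nonneg hq h1')
    (time_le_last hq h1' h2'.le) he with ⟨hIJ, htt⟩ | ⟨hIJ, e1, e2⟩ | ⟨hIJ, -, -⟩
  · rw [← hIJ] at htt
    exact (time_lt hq h1 hlt).ne htt
  · have := time_lt hq h1 h2
    rw [time_last hq] at this
    linarith
  · have := hm.monotone (show J + 1 ≤ I by omega)
    omega

lemma eq_of_pos_mem_arc {w τ : ℕ} (h : pos q w ∈ arc q τ) : w = τ ∨ w = τ + 1 := by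
  rcases lt_trichotomy w τ with hlt | rfl | hlt
  · exact Or.inl (pos_injective hq (eq_of_mem_arc hq hlt (pos_mem_arc hq w) h).2)
  · exact Or.inl rfl
  · exact Or.inr (eq_of_mem_arc hq hlt h (pos_mem_arc hq w)).1

lemma mem_spoke_of_mem_arc {τ i : ℕ} {z : ℝ × ℝ} (hz : z ∈ arc q τ) (hz' : z ∈ spoke i) :
    z = pos q (lo q i) ∨ z = pos q (hi q i) := by
  obtain ⟨h1, h2⟩ := stage_spec hq τ
  obtain ⟨t, ⟨ht1, ht2⟩, rfl⟩ := hz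
  rw [pos_lo hq, pos_hi hq]
  have b1 := time_nonneg hq h1
  have b2 := time_le_last hq (show start q (stage q τ) ≤ τ + 1 by omega) h2
  exact spoke_inter_spiral (by linarith) (by linarith) hz'

end

/-- A path with `2 * M + 1` chords. -/
def graph (q M : ℕ) : SimpleGraph (Fin (q * (M + 1) + 2)) :=
  SimpleGraph.fromRel fun a b =>
    b.1 = a.1 + 1 ∨ ∃ i ≤ 2 * M, a.1 = lo q i ∧ b.1 = hi q i

lemma lo_lt_hi (q i : ℕ) : lo q i + (q + 1) ≤ hi q i := by
  simp only [lo, hi]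
  omega

lemma hi_lt {q M i : ℕ} (h : i ≤ 2 * M) : hi q i < q * (M + 1) + 2 := by
  have h1 : q * i ≤ q * (2 * M) := Nat.mul_le_mul_left q h
  have h2 : q * (2 * M) = 2 * (q * M) := by ring
  simp only [hi, Nat.mul_add]
  omega

/-- The first end of an edge. -/
def edgeFst (q M : ℕ) : Fin (q * (M + 1) + 1) ⊕ Fin (2 * M + 1) → Fin (q * (M + 1) + 2)
  | .inl τ => ⟨τ.1, by omega⟩
  | .inr i => ⟨lo q i, by
      have := hi_lt (q := q) (Nat.lt_succ_iff.mp i.2)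
      have := lo_lt_hi q i
      omega⟩

/-- The second end of an edge. -/
def edgeSnd (q M : ℕ) : Fin (q * (M + 1) + 1) ⊕ Fin (2 * M + 1) → Fin (q * (M + 1) + 2)
  | .inl τ => ⟨τ.1 + 1, by omega⟩
  | .inr i => ⟨hi q i, hi_lt (Nat.lt_succ_iff.mp i.2)⟩

lemma adj_iff {q M : ℕ} {a b : Fin (q * (M + 1) + 2)} (hab : a.1 < b.1) : (graph q M).Adj a b ↔
    b.1 = a.1 + 1 ∨ ∃ i ≤ 2 * M, a.1 = lo q i ∧ b.1 = hi q i := by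
  rw [graph, SimpleGraph.fromRel_adj]
  constructor
  · rintro ⟨-, h | h | ⟨i, -, h1, h2⟩⟩
    · exact h
    · omega
    · have := lo_lt_hi q i
      omega
  · exact fun h => ⟨fun he => hab.ne (congrArg Fin.val he), Or.inl h⟩

lemma edgeFst_lt_edgeSnd {q M : ℕ} (e : Fin (q * (M + 1) + 1) ⊕ Fin (2 * M + 1)) :
    (edgeFst q M e).1 < (edgeSnd q M e).1 := by
  rcases e with τ | i
  · exact Nat.lt_succ_self _
  · have := lo_lt_hi q i
    simp only [edgeFst, edgeSnd]
    omega

lemma adj_iff_exists {q M : ℕ} (u v : Fin (q * (M + 1) + 2)) : (graph q M).Adj u v ↔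
    ∃ e, s(edgeFst q M e, edgeSnd q M e) = s(u, v) := by
  constructor
  · intro h
    wlog huv : u.1 < v.1 generalizing u v
    · have hne : u.1 ≠ v.1 := fun he => h.ne (Fin.ext he)
      rw [Sym2.eq_swap]
      exact this v u h.symm (by omega)
    rcases (adj_iff huv).mp h with h | ⟨i, hi, h1, h2⟩
    · exact ⟨.inl ⟨u.1, by omega⟩, Sym2.eq_iff.mpr (Or.inl ⟨Fin.ext rfl, Fin.ext h.symm⟩)⟩
    · exact ⟨.inr ⟨i, by omega⟩, Sym2.eq_iff.mpr (Or.inl ⟨Fin.ext h1.symm, Fin.ext h2.symm⟩)⟩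
  · rintro ⟨e, he⟩
    have h : (graph q M).Adj (edgeFst q M e) (edgeSnd q M e) := by
      rw [adj_iff (edgeFst_lt_edgeSnd e)]
      rcases e with τ | i
      · exact Or.inl rfl
      · exact Or.inr ⟨i, by omega, rfl, rfl⟩
    rcases Sym2.eq_iff.mp he with ⟨rfl, rfl⟩ | ⟨rfl, rfl⟩
    · exact h
    · exact h.symm

lemma lo_injective {q : ℕ} (hq : 2 ≤ q) : Function.Injective (lo q) := by
  refine StrictMono.injective (strictMono_nat_of_lt_succ fun i => ?_)
  simp only [lo, Nat.mul_add]
  omega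

lemma hi_injective {q : ℕ} (hq : 2 ≤ q) : Function.Injective (hi q) := by
  refine StrictMono.injective (strictMono_nat_of_lt_succ fun i => ?_)
  simp only [hi, Nat.mul_add]
  omega

lemma edge_injective {q M : ℕ} (hq : 2 ≤ q) :
    Function.Injective fun e => s(edgeFst q M e, edgeSnd q M e) := by
  intro e f h
  have h1 := edgeFst_lt_edgeSnd e
  have h2 := edgeFst_lt_edgeSnd f
  have h3 : (edgeFst q M e).1 = (edgeFst q M f).1 ∧ (edgeSnd q M e).1 = (edgeSnd q M f).1 := by
    rcases Sym2.eq_iff.mp h with ⟨h3, h4⟩ | ⟨h3, h4⟩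
    · rw [h3, h4]
      exact ⟨rfl, rfl⟩
    · rw [h3, h4] at h1
      omega
  rcases e with τ | i <;> rcases f with τ' | i' <;> simp only [edgeFst, edgeSnd] at h3
  · rw [Fin.ext h3.1]
  · have := lo_lt_hi q i'
    omega
  · have := lo_lt_hi q i
    omega
  · rw [Fin.ext (lo_injective hq h3.1)]

lemma isPlanarGraph {q : ℕ} (hq : 4 ≤ q) (M : ℕ) : IsPlanarGraph (graph q M) := by
  refine isPlanarGraph_of_arcs (edgeFst q M) (edgeSnd q M) (fun v => pos q v.1)
    (Sum.elim (fun τ => arc q τ) (fun i => spoke i))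
    (fun u v h => Fin.ext (pos_injective hq h)) adj_iff_exists (edge_injective (by omega)) ?_ ?_ ?_
  · rintro (τ | i)
    · exact isPolygonalArc_arc hq τ
    · simp only [edgeFst, edgeSnd, pos_lo hq, pos_hi hq]
      exact isPolygonalArc_spoke i
  · rintro (τ | i) w hw
    · rcases eq_of_pos_mem_arc hq hw with h | h
      · exact Or.inl (Fin.ext h)
      · exact Or.inr (Fin.ext h)
    · rcases mem_spoke_of_mem_arc hq (pos_mem_arc hq w) hw with h | h
      · exact Or.inl (Fin.ext (pos_injective hq h))
      · exact Or.inr (Fin.ext (pos_injective hq h))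
  · have h1 : ∀ (τ : Fin (q * (M + 1) + 1)) (i : Fin (2 * M + 1)) (z : ℝ × ℝ), z ∈ arc q τ →
        z ∈ spoke i → z ∈ Set.range fun v : Fin (q * (M + 1) + 2) => pos q v.1 := by
      intro τ i z hz hz'
      rcases mem_spoke_of_mem_arc hq hz hz' with h | h
      · exact ⟨edgeFst q M (.inr i), h.symm⟩
      · exact ⟨edgeSnd q M (.inr i), h.symm⟩
    have h2 : ∀ (τ τ' : Fin (q * (M + 1) + 1)) (z : ℝ × ℝ), τ.1 < τ'.1 → z ∈ arc q τ →
        z ∈ arc q τ' → z ∈ Set.range fun v : Fin (q * (M + 1) + 2) => pos q v.1 := by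
      intro τ τ' z hlt hz hz'
      exact ⟨edgeFst q M (.inl τ'), (eq_of_mem_arc hq hlt hz hz').2.symm⟩
    rintro (τ | i) (τ' | i') hne z ⟨hz, hz'⟩
    · rcases lt_trichotomy τ.1 τ'.1 with h | h | h
      · exact h2 τ τ' z h hz hz'
      · exact absurd (by rw [Fin.ext h]) hne
      · exact h2 τ' τ z h hz' hz
    · exact h1 τ i' z hz hz'
    · exact h1 τ' i z hz' hz
    · refine (Set.disjoint_left.mp (disjoint_spoke fun h => hne ?_) hz hz').elim
      rw [Fin.ext h]

end SpiralGraph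

/-! ### The girth is at least q + 2: a Lipschitz potential. -/

/-- A function that changes by at most one along the edges of a walk bounds its length. -/
lemma SimpleGraph.Walk.abs_sub_le_length {V : Type*} {G : SimpleGraph V} {u v : V} (p : G.Walk u v)
    (f : V → ℤ) (h : ∀ x y, s(x, y) ∈ p.edges → |f x - f y| ≤ 1) : |f u - f v| ≤ p.length := by
  induction p with
  | nil => simp
  | @cons u x v hux p ih =>
    have h1 := h u x (by simp)
    have h2 := ih fun a b hab => h a b (by simp [hab])
    have h3 := abs_sub_le (f u) (f x) (f v)
    rw [Walk.length_cons]
    push_cast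
    linarith

/-- The distance from `0` to `x` on a cycle of length `g`. -/
def circDist (g x : ℤ) : ℤ := min (x % g) (g - x % g)

lemma circDist_add_self (g x : ℤ) : circDist g (x + g) = circDist g x := by
  simp [circDist]

lemma circDist_of_lt {g x : ℤ} (h0 : 0 ≤ x) (h1 : x < g) : circDist g x = min x (g - x) := by
  rw [circDist, Int.emod_eq_of_lt h0 h1]

lemma abs_circDist_succ_sub {g : ℤ} (hg : 0 < g) (x : ℤ) :
    |circDist g (x + 1) - circDist g x| ≤ 1 := by
  have h0 := Int.emod_nonneg x hg.ne'
  have h1 := Int.emod_lt_of_pos x hg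
  have h2 : circDist g (x + 1) = circDist g (x % g + 1) := by
    simp [circDist]
  rw [h2]
  rcases eq_or_lt_of_le (show x % g + 1 ≤ g by omega) with h3 | h3
  · have : circDist g (x % g + 1) = 0 := by
      rw [h3, circDist, Int.emod_self]
      omega
    rw [this, circDist, abs_le]
    omega
  · rw [circDist_of_lt (by omega) h3, circDist, abs_le]
    omega

namespace SpiralGraph

/-- A function on the vertices up to `hi q i` that changes by at most one along all edges but the
`i`-th chord. -/
def potential (q i τ : ℕ) : ℤ :=
  if τ + q ≤ hi q i then circDist (q + 2) ((τ : ℤ) - lo q i)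
  else (q : ℤ) + 1 - hi q i + τ

lemma lo_add_hi (q i : ℕ) : lo q i + hi q i = q + 1 + q * i := by
  simp only [lo, hi]
  omega

lemma lo_succ_le (q i : ℕ) : lo q (i + 1) ≤ lo q i + (q + 1) / 2 := by
  simp only [lo, Nat.mul_add]
  omega

lemma lo_succ_ge (q i : ℕ) : lo q i + q / 2 ≤ lo q (i + 1) := by
  simp only [lo, Nat.mul_add]
  omega

lemma hi_le (q i : ℕ) : hi q i ≤ lo q i + (q + 2) := by
  simp only [lo, hi]
  omega

lemma hi_add_two (q i : ℕ) : hi q (i + 2) = hi q i + q := by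
  simp only [hi, Nat.mul_add]
  omega

lemma hi_strictMono {q : ℕ} (hq : 2 ≤ q) : StrictMono (hi q) := by
  refine strictMono_nat_of_lt_succ fun i => ?_
  simp only [hi, Nat.mul_add]
  omega

/-- The two formulas fit together: at τ = hi - q the circular distance is hi - lo - q, which is 1 or
2, and the linear part continues with the value 2. -/
lemma abs_potential_succ_sub {q : ℕ} (hq : 4 ≤ q) (i τ : ℕ) :
    |potential q i τ - potential q i (τ + 1)| ≤ 1 := by
  have h1 := lo_lt_hi q i
  have h2 := hi_le q i
  unfold potential
  rcases lt_trichotomy (τ + q) (hi q i) with h | h | h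
  · rw [if_pos (by omega), if_pos (by omega), abs_sub_comm]
    have := abs_circDist_succ_sub (g := (q : ℤ) + 2) (by omega) ((τ : ℤ) - lo q i)
    rw [show ((τ + 1 : ℕ) : ℤ) - lo q i = (τ : ℤ) - lo q i + 1 by push_cast; ring]
    exact this
  · rw [if_pos (by omega), if_neg (by omega), circDist_of_lt (by omega) (by omega), abs_le]
    omega
  · rw [if_neg (by omega), if_neg (by omega), abs_le]
    omega

/-- Chords with k ≤ i - 2 have both ends in the circular range, and their span is q + 1 or q + 2,
which is -1 or 0 modulo q + 2. The outer end of chord i - 1 is in the linear range, and the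
potential is about q/2 at both of its ends. -/
lemma abs_potential_chord_sub {q : ℕ} (hq : 4 ≤ q) {i k : ℕ} (hk : k < i) :
    |potential q i (lo q k) - potential q i (hi q k)| ≤ 1 := by
  have h1 := lo_lt_hi q i
  have h2 := hi_le q i
  have h1' := lo_lt_hi q k
  have h2' := hi_le q k
  have h3 : 0 < (q : ℤ) + 2 := by omega
  unfold potential
  rcases eq_or_lt_of_le (Nat.succ_le_of_lt hk) with h | h
  · obtain rfl : k + 1 = i := h
    have h4 := lo_succ_le q k
    have h5 := lo_succ_ge q k
    have h6 := lo_add_hi q k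
    have h7 := lo_add_hi q (k + 1)
    rw [Nat.mul_add] at h7
    rw [if_pos (by omega), if_neg (by omega), ← circDist_add_self,
      circDist_of_lt (by omega) (by omega), abs_le]
    omega
  · obtain ⟨j, rfl⟩ : ∃ j, i = j + 2 := ⟨i - 2, by omega⟩
    have h4 : hi q k ≤ hi q j := (hi_strictMono (by omega)).monotone (by omega)
    have h5 := hi_add_two q j
    rw [if_pos (by omega), if_pos (by omega)]
    have h6 : hi q k = lo q k + (q + 1) ∨ hi q k = lo q k + (q + 2) := by omega
    rcases h6 with h6 | h6
    · have := abs_circDist_succ_sub h3 ((lo q k : ℤ) - lo q (j + 2) - 1)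
      rw [sub_add_cancel] at this
      rw [h6, ← circDist_add_self _ ((lo q k : ℤ) - lo q (j + 2) - 1)] at *
      rw [show ((lo q k + (q + 1) : ℕ) : ℤ) - lo q (j + 2) =
        (lo q k : ℤ) - lo q (j + 2) - 1 + (q + 2) by push_cast; ring]
      exact this
    · rw [h6, show ((lo q k + (q + 2) : ℕ) : ℤ) - lo q (j + 2) =
        (lo q k : ℤ) - lo q (j + 2) + (q + 2) by push_cast; ring, circDist_add_self]
      simp

/-- A cycle whose largest vertex is followed by the inner end of a chord is long. -/
lemma le_length_of_snd {q M i : ℕ} (hq : 4 ≤ q) {m : Fin (q * (M + 1) + 2)}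
    {c : (graph q M).Walk m m} (hc : c.IsCycle) (hmax : ∀ x ∈ c.support, x.1 ≤ m.1)
    (hm : m.1 = hi q i) (hsnd : c.snd.1 = lo q i) : q + 2 ≤ c.length := by
  cases c with
  | nil => exact absurd SimpleGraph.Walk.nil_nil hc.not_nil
  | @cons _ v _ h p =>
    rw [SimpleGraph.Walk.snd_cons] at hsnd
    have hp := ((SimpleGraph.Walk.cons_isCycle_iff p h).mp hc).2
    -- The rest `p` of the cycle stays at or below `hi q i` and does not reuse chord i, so its
    -- chords have index less than i and the potential is 1-Lipschitz along it.
    have key := p.abs_sub_le_length (fun x => potential q i x.1) (by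
      intro x y hxy
      wlog hlt : x.1 < y.1 generalizing x y
      · have hadj : (graph q M).Adj x y := p.edges_subset_edgeSet hxy
        have hne : x.1 ≠ y.1 := fun he => hadj.ne (Fin.ext he)
        rw [abs_sub_comm]
        exact this y x (by rwa [Sym2.eq_swap]) (by omega)
      have hy : y.1 ≤ m.1 := hmax y (by
        rw [SimpleGraph.Walk.support_cons]
        exact List.mem_cons_of_mem _ (p.snd_mem_support_of_mem_edges hxy))
      rcases (adj_iff hlt).mp (p.edges_subset_edgeSet hxy) with h1 | ⟨k, -, h1, h2⟩
      · simp only [h1]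
        exact abs_potential_succ_sub hq i x
      · simp only [h1, h2]
        refine abs_potential_chord_sub hq ?_
        rw [h2, hm] at hy
        rcases eq_or_lt_of_le ((hi_strictMono (by omega)).le_iff_le.mp hy) with rfl | hk
        · exfalso
          apply hp
          rw [Sym2.eq_swap]
          convert hxy using 2
          · exact Fin.ext (hsnd.trans h1.symm)
          · exact Fin.ext (hm.trans h2.symm)
        · exact hk)
    have h1 := lo_lt_hi q i
    have h2 := hi_le q i
    have e1 : potential q i v.1 = 0 := by
      rw [hsnd, potential, if_pos (by omega), sub_self, circDist_of_lt le_rfl (by omega)]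
      omega
    have e2 : potential q i m.1 = q + 1 := by
      rw [hm, potential, if_neg (by omega)]
      omega
    rw [e1, e2, abs_le] at key
    rw [SimpleGraph.Walk.length_cons]
    omega

/-- The largest vertex m of a cycle has two distinct smaller neighbours on it. At most one of them
is m - 1, so the other is reached by a chord with outer end m; the cycle is reversed if necessary to
start with that chord. -/
lemma le_length {q M : ℕ} (hq : 4 ≤ q) {a : Fin (q * (M + 1) + 2)} {w : (graph q M).Walk a a}
    (hw : w.IsCycle) : q + 2 ≤ w.length := by
  obtain ⟨m, hm, hmax⟩ := w.support.toFinset.exists_max_image (fun x => x.1) ⟨a, by simp⟩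
  simp only [List.mem_toFinset] at hm hmax
  set c := w.rotate m hm
  have hc : c.IsCycle := hw.rotate hm
  have hlen : c.length = w.length := w.length_rotate m hm
  have hcmax : ∀ x ∈ c.support, x.1 ≤ m.1 := fun x hx =>
    hmax x ((w.mem_support_rotate_iff m hm).mp hx)
  rw [← hlen]
  have hadj1 : (graph q M).Adj c.snd m := (c.adj_snd hc.not_nil).symm
  have hadj2 : (graph q M).Adj c.penultimate m := c.adj_penultimate hc.not_nil
  have hlt : ∀ x, (graph q M).Adj x m → x ∈ c.support → x.1 < m.1 := fun x h1 h2 =>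
    lt_of_le_of_ne (hcmax x h2) fun he => h1.ne (Fin.ext he)
  have hlt1 := hlt _ hadj1 (c.getVert_mem_support 1)
  have hlt2 := hlt _ hadj2 (c.getVert_mem_support _)
  rcases (adj_iff hlt1).mp hadj1 with h1 | ⟨i, -, h1, h2⟩
  · rcases (adj_iff hlt2).mp hadj2 with h3 | ⟨i, -, h3, h4⟩
    · exact absurd (Fin.ext (by omega)) hc.snd_ne_penultimate
    · rw [← c.length_reverse]
      refine le_length_of_snd hq hc.reverse (fun x hx => hcmax x ?_) h4 ?_
      · rwa [SimpleGraph.Walk.support_reverse, List.mem_reverse] at hx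
      · rwa [SimpleGraph.Walk.snd_reverse]
  · exact le_length_of_snd hq hc hcmax h2 h1

/-! ### Number of edges, girth and degrees of the extremal graph. -/

lemma card_edgeFinset {q M : ℕ} (hq : 2 ≤ q) [Fintype (graph q M).edgeSet] :
    (graph q M).edgeFinset.card = (q + 2) * (M + 1) := by
  classical
  have h : (graph q M).edgeFinset =
      Finset.univ.image fun e => s(edgeFst q M e, edgeSnd q M e) := by
    ext e
    induction e with
    | h u v =>
      rw [SimpleGraph.mem_edgeFinset, SimpleGraph.mem_edgeSet, adj_iff_exists]
      simp
  rw [h, Finset.card_image_of_injective _ (edge_injective hq)]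
  simp only [Finset.card_univ, Fintype.card_sum, Fintype.card_fin]
  ring

lemma card_edgeFinset_eq {q M : ℕ} (hq : 2 ≤ q) [Fintype (graph q M).edgeSet] :
    ((graph q M).edgeFinset.card : ℝ) =
      ((q + 2 : ℕ) : ℝ) / (((q + 2 : ℕ) : ℝ) - 2) * (((q * (M + 1) + 2 : ℕ) : ℝ) - 2) := by
  have : (q : ℝ) ≠ 0 := by
    have : q ≠ 0 := by omega
    exact_mod_cast this
  rw [card_edgeFinset hq]
  push_cast
  rw [add_sub_cancel_right, add_sub_cancel_right]
  field_simp

/-- No cycle of length q + 2 is exhibited: for girth γ the upper bound reads (q + 2)(γ - 2) ≤ γ q,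
that is, γ ≤ q + 2. -/
lemma girth_eq {q : ℕ} (hq : 4 ≤ q) (M : ℕ) : (graph q M).girth = q + 2 := by
  classical
  have hcard := card_edgeFinset (q := q) (M := M) (by omega)
  have hcyc : ¬ (graph q M).IsAcyclic := by
    apply SimpleGraph.not_isAcyclic_of_card_le
    rw [← SimpleGraph.edgeFinset_card, hcard, Fintype.card_fin, Nat.add_mul]
    omega
  obtain ⟨a, w, hw, hlen⟩ := SimpleGraph.exists_girth_eq_length.mpr hcyc
  have hge := le_length hq hw
  rw [← hlen] at hge
  refine le_antisymm ?_ hge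
  have h := (isPlanarGraph hq M).card_edgeFinset_le (g := (graph q M).girth) (by omega) rfl
  have hg : ((q : ℝ) + 2) ≤ (graph q M).girth := by exact_mod_cast hge
  have hq' : (4 : ℝ) ≤ q := by exact_mod_cast hq
  have hM : (0 : ℝ) ≤ M := Nat.cast_nonneg M
  rw [hcard, div_mul_eq_mul_div, le_div_iff₀ (by linarith), Fintype.card_fin] at h
  push_cast at h
  have h2 : ((q + 2) * ((graph q M).girth - 2) : ℝ) ≤ (graph q M).girth * q := by
    refine le_of_mul_le_mul_right ?_ (show (0 : ℝ) < M + 1 by linarith)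
    linarith
  have : ((graph q M).girth : ℝ) ≤ q + 2 := by linarith
  exact_mod_cast this

/-- The vertex `hi q j` lies strictly between `lo q (j + 2)` and `lo q (j + 3)`. -/
lemma lo_ne_hi {q : ℕ} (hq : 4 ≤ q) (i j : ℕ) : lo q i ≠ hi q j := by
  intro h
  rcases le_or_gt i (j + 2) with hij | hij
  · have h1 : q * i ≤ q * (j + 2) := Nat.mul_le_mul_left q hij
    simp only [lo, hi, Nat.mul_add] at h h1
    omega
  · obtain ⟨k, rfl⟩ : ∃ k, i = j + 3 + k := ⟨i - (j + 3), by omega⟩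
    have h1 : q * j % 2 = 0 ∨ q ≠ 4 := by
      by_cases hq4 : q = 4
      · subst hq4
        omega
      · exact Or.inr hq4
    simp only [lo, hi, Nat.mul_add] at h
    rcases eq_or_lt_of_le hq with rfl | hq
    · omega
    · omega

/-- No two chords share a vertex, so a vertex has at most one neighbour besides its neighbours on
the path. The path's ends are `lo q 0` and `hi q (2 * M)`, so they too have degree at least 2. -/
lemma degree_eq {q M : ℕ} (hq : 4 ≤ q) [DecidableRel (graph q M).Adj]
    (v : Fin (q * (M + 1) + 2)) : (graph q M).degree v = 2 ∨ (graph q M).degree v = 3 := by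
  classical
  have hlast : hi q (2 * M) = q * (M + 1) + 1 := by
    rw [hi, show q * (2 * M) = 2 * (q * M) by ring, Nat.mul_add]
    omega
  have hadj : ∀ w, (graph q M).Adj v w ↔ w.1 = v.1 + 1 ∨ v.1 = w.1 + 1 ∨
      (∃ i ≤ 2 * M, v.1 = lo q i ∧ w.1 = hi q i) ∨ ∃ i ≤ 2 * M, w.1 = lo q i ∧ v.1 = hi q i := by
    intro w
    rw [graph, SimpleGraph.fromRel_adj]
    constructor
    · rintro ⟨-, (h | h) | h | h⟩
      exacts [Or.inl h, Or.inr (Or.inr (Or.inl h)), Or.inr (Or.inl h), Or.inr (Or.inr (Or.inr h))]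
    · intro h
      refine ⟨?_, ?_⟩
      swap
      · rcases h with h | h | h | h
        exacts [Or.inl (Or.inl h), Or.inr (Or.inl h), Or.inl (Or.inr h), Or.inr (Or.inr h)]
      rintro rfl
      rcases h with h | h | ⟨i, -, h1, h2⟩ | ⟨i, -, h1, h2⟩
      · omega
      · omega
      · have := lo_lt_hi q i
        omega
      · have := lo_lt_hi q i
        omega
  obtain ⟨p, hp⟩ : ∃ p, ∀ w, (graph q M).Adj v w → w.1 = v.1 + 1 ∨ w.1 = v.1 - 1 ∨ w.1 = p := by
    by_cases h1 : ∃ i, v.1 = lo q i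
    · obtain ⟨i, h1⟩ := h1
      refine ⟨hi q i, fun w hw => ?_⟩
      rcases (hadj w).mp hw with h | h | ⟨j, -, h2, h3⟩ | ⟨j, -, h2, h3⟩
      · omega
      · omega
      · rw [lo_injective (by omega) (h1.symm.trans h2)]
        omega
      · exact absurd (h1.symm.trans h3) (lo_ne_hi hq _ _)
    · by_cases h2 : ∃ i, v.1 = hi q i
      · obtain ⟨i, h2⟩ := h2
        refine ⟨lo q i, fun w hw => ?_⟩
        rcases (hadj w).mp hw with h | h | ⟨j, -, h3, h4⟩ | ⟨j, -, h3, h4⟩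
        · omega
        · omega
        · exact absurd (h3.symm.trans h2) (lo_ne_hi hq _ _)
        · rw [hi_injective (by omega) (h2.symm.trans h4)]
          omega
      · refine ⟨0, fun w hw => ?_⟩
        rcases (hadj w).mp hw with h | h | ⟨j, -, h3, h4⟩ | ⟨j, -, h3, h4⟩
        · omega
        · omega
        · exact absurd ⟨j, h3⟩ h1
        · exact absurd ⟨j, h4⟩ h2
  have hle : (graph q M).degree v ≤ 3 := by
    rw [← SimpleGraph.card_neighborFinset_eq_degree,
      ← Finset.card_map ⟨Fin.val, Fin.val_injective⟩]
    refine (Finset.card_le_card ?_).trans (Finset.card_le_three (a := v.1 + 1) (b := v.1 - 1)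
      (c := p))
    intro x hx
    obtain ⟨w, hw, rfl⟩ := Finset.mem_map.mp hx
    rw [SimpleGraph.mem_neighborFinset] at hw
    simpa using hp w hw
  obtain ⟨x, y, hx, hy, hxy⟩ : ∃ x y, (graph q M).Adj v x ∧ (graph q M).Adj v y ∧ x ≠ y := by
    by_cases h0 : v.1 = 0
    · refine ⟨⟨1, by omega⟩, ⟨hi q 0, hi_lt (Nat.zero_le _)⟩, (hadj _).mpr ?_, (hadj _).mpr ?_, ?_⟩
      · left
        simp [h0]
      · right; right; left
        exact ⟨0, Nat.zero_le _, by simp [h0, lo], rfl⟩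
      · have := lo_lt_hi q 0
        intro h
        have := congrArg Fin.val h
        simp only at this
        omega
    · by_cases h1 : v.1 = q * (M + 1) + 1
      · have hl := lo_lt_hi q (2 * M)
        refine ⟨⟨v.1 - 1, by omega⟩, ⟨lo q (2 * M), by omega⟩, (hadj _).mpr ?_, (hadj _).mpr ?_, ?_⟩
        · right; left
          simp only
          omega
        · right; right; right
          exact ⟨2 * M, le_rfl, rfl, by omega⟩
        · intro h
          have := congrArg Fin.val h
          simp only at this
          omega
      · refine ⟨⟨v.1 - 1, by omega⟩, ⟨v.1 + 1, by omega⟩, (hadj _).mpr ?_, (hadj _).mpr ?_, ?_⟩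
        · right; left
          simp only
          omega
        · left
          rfl
        · intro h
          have := congrArg Fin.val h
          simp only at this
          omega
  have hge : 1 < (graph q M).degree v := by
    rw [← SimpleGraph.card_neighborFinset_eq_degree, Finset.one_lt_card]
    exact ⟨x, by simpa using hx, y, by simpa using hy, hxy⟩
  omega

end SpiralGraph

/-! ### The theorem. -/

theorem lemma1 :
    (∀ g : ℕ, 3 ≤ g →
      ∀ (V : Type*) [Fintype V] [DecidableEq V] (G : SimpleGraph V) [DecidableRel G.Adj],
        IsPlanarGraph G → G.girth = g →
          (G.edgeFinset.card : ℝ) ≤ (g : ℝ) / ((g : ℝ) - 2) * ((Fintype.card V : ℝ) - 2)) ∧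
    (∀ g : ℕ, 6 ≤ g →
      {n : ℕ | ∃ (G : SimpleGraph (Fin n)) (_ : DecidableRel G.Adj),
        IsPlanarGraph G ∧ G.girth = g ∧
          (G.edgeFinset.card : ℝ) = (g : ℝ) / ((g : ℝ) - 2) * ((n : ℝ) - 2)}.Infinite ∧
      ∀ k : ℕ, 0 < k → Even k →
        ∀ n : ℕ, (n : ℝ) = (5 * (g : ℝ) - 10) * ((k : ℝ) / 2) - (g : ℝ) + 4 →
          ∃ (G : SimpleGraph (Fin n)) (_ : DecidableRel G.Adj),
            IsPlanarGraph G ∧ G.girth = g ∧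
              (G.edgeFinset.card : ℝ) = (g : ℝ) / ((g : ℝ) - 2) * ((n : ℝ) - 2) ∧
              ∀ v, G.degree v = 2 ∨ G.degree v = 3) := by
  classical
  refine ⟨fun g hg V _ _ G _ hG h => hG.card_edgeFinset_le hg h, fun g hg => ?_⟩
  obtain ⟨q, rfl⟩ : ∃ q, g = q + 2 := ⟨g - 2, by omega⟩
  have hq : 4 ≤ q := by omega
  constructor
  · refine Set.infinite_of_injective_forall_mem (f := fun M : ℕ => q * (M + 1) + 2) ?_ fun M =>
      ⟨SpiralGraph.graph q M, Classical.decRel _, SpiralGraph.isPlanarGraph hq M,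
        SpiralGraph.girth_eq hq M, SpiralGraph.card_edgeFinset_eq (by omega)⟩
    intro M M' h
    have := Nat.eq_of_mul_eq_mul_left (by omega) (Nat.add_right_cancel h)
    omega
  · rintro k hk ⟨j, rfl⟩ n hn
    -- For k = 2j the prescribed n is q(5j - 1) + 2, so M + 1 = 5j - 1; since k > 0 there is no
    -- truncation.
    obtain ⟨M, hM⟩ : ∃ M, 5 * j = M + 2 := ⟨5 * j - 2, by omega⟩
    have hM' : (5 : ℝ) * j = M + 2 := by exact_mod_cast hM
    have hn' : n = q * (M + 1) + 2 := by
      have : (n : ℝ) = ((q * (M + 1) + 2 : ℕ) : ℝ) := by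
        rw [hn]
        push_cast
        linear_combination (q : ℝ) * hM'
      exact_mod_cast this
    subst hn'
    exact ⟨SpiralGraph.graph q M, Classical.decRel _, SpiralGraph.isPlanarGraph hq M,
      SpiralGraph.girth_eq hq M, SpiralGraph.card_edgeFinset_eq (by omega),
      SpiralGraph.degree_eq hq⟩
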